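/- Let $q$ be an odd prime power, let $r\ge 2$ be an integer, and let $a\in\mathrm{GF}(q^2)\setminus\{0\}$ and $b\in\mathrm{GF}(q^2)\setminus\mathrm{GF}(q)$ satisfy $4a^{q+1}+(b^q-b)^2=0$. Let $\mathcal B(a,b)$ be the set of points $(x_1,\dots,x_r)$ of the affine space $\mathrm{AG}(r,q^2)$ with $$x_r^q-x_r+a^q(x_1^{2q}+\dots+x_{r-1}^{2q})-a(x_1^2+\dots+x_{r-1}^2)=(b^q-b)(x_1^{q+1}+\dots+x_{r-1}^{q+1}),$$ regarded as a set of points of $\mathrm{PG}(r,q^2)$ by identifying $(x_1,\dots,x_r)$ with the point of homogeneous coordinates $(1,x_1,\dots,x_r)$. Then $\mathcal B(a,b)$ has exactly $q^{2r-1}$ points. Let $\mathcal C$ be a linear code over $\mathrm{GF}(q^2)$ generated from $\mathcal B(a,b)$, that is, the row space of a matrix whose columns are coordinate vectors (normalized in any way and listed in any order) of the points of $\mathcal B(a,b)$, each point occurring exactly once. Then $\mathcal C$ has length $q^{2r-1}$ and dimension $r+1$, and it is projective (no coordinate vanishes identically on $\mathcal C$, and no two distinct coordinates are proportional on $\mathcal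 C$). Let $A_i$ be the number of codewords of $\mathcal C$ of Hamming weight $i$. The weight enumerator $w(x)=\sum_i A_ix^i$ is as follows. * If $r\equiv 1\pmod 4$, or $r$ is odd and $q\equiv 1\pmod 4$, then $$w(x)=1+(q^2-1)x^{q^{2r-1}}+(q^{r+2}-q^r)\,x^{q^{2r-1}-q^{2r-3}-q^{3(r-1)/2}+q^{(3r-5)/2}}$$ $$\qquad+\bigl(q^{2r}-q^2+(q^{2r}-q^{r+1})(q^2-1)\bigr)x^{q^{2r-1}-q^{2r-3}}+(q^{r+1}-q^r)(q^2-1)\,x^{q^{2r-1}-q^{2r-3}+q^{(3r-5)/2}}.$$ * If $r\equiv 3\pmod 4$ and $q\equiv 3\pmod 4$, then $$w(x)=1+(q^2-1)x^{q^{2r-1}}+(q^{r+1}-q^r)(q^2-1)\,x^{q^{2r-1}-q^{2r-3}-q^{(3r-5)/2}}$$ $$\qquad+\bigl(q^{2r}-q^2+(q^{2r}-q^{r+1})(q^2-1)\bigr)x^{q^{2r-1}-q^{2r-3}}+(q^{r+2}-q^r)\,x^{q^{2r-1}-q^{2r-3}+q^{3(r-1)/2}-q^{(3r-5)/2}}.$$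 * If $r$ is even, then $$w(x)=1+(q^2-1)x^{q^{2r-1}}+\tfrac12(q^{r+1}-q^r)(q^2-1)\bigl(x^{q^{2r-1}-q^{2r-3}+q^{(3r-4)/2}}+x^{q^{2r-1}-q^{2r-3}-q^{(3r-4)/2}}\bigr)$$ $$\qquad+\bigl(q^{2r}+q^{r+2}-q^r-q^2+(q^{2r}-q^{r+1})(q^2-1)\bigr)x^{q^{2r-1}-q^{2r-3}}.$$ If moreover $r\ge 3$, then $A_{q^{2r-1}}=q^2-1$ and $\mathcal C$ has exactly four nonzero weights. -/

import Mathlib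

open scoped LinearAlgebra.Projectivization

namespace FourWeightCode

/-- The affine algebraic set `B(a,b)` of `AG(r,q²)`, written in homogeneous coordinates
`(X_0, X_1, …, X_r)` normalised by `X_0 = 1`: the affine point `(x_1, …, x_r)` is the vector
`x : Fin (r + 1) → F` with `x 0 = 1`, the last coordinate `x_r` is `x (Fin.last r)`, and the
indices strictly between `0` and `Fin.last r` are exactly `1, …, r - 1`. Here `F = GF(q²)`. -/
def affineSet {F : Type*} [Field F] (q r : ℕ) (a b : F) : Set (Fin (r + 1) → F) :=
  {x | x 0 = 1 ∧
    x (Fin.last r) ^ q - x (Fin.last r)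
        + a ^ q * (∑ i ∈ Finset.Ioo 0 (Fin.last r), x i ^ (2 * q))
        - a * (∑ i ∈ Finset.Ioo 0 (Fin.last r), x i ^ 2)
      = (b ^ q - b) * ∑ i ∈ Finset.Ioo 0 (Fin.last r), x i ^ (q + 1)}

/-- `B(a,b)` as a set of points of the projective space `PG(r,q²)`. -/
def pointSet {F : Type*} [Field F] (q r : ℕ) (a b : F) : Set (ℙ F (Fin (r + 1) → F)) :=
  {P | ∃ (x : Fin (r + 1) → F) (hx : x ≠ 0),
    x ∈ affineSet q r a b ∧ P = Projectivization.mk F x hx}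

/-- The columns of `G` are coordinate vectors (normalised in any way and listed in any order)
of the points of `S`, each point of `S` occurring exactly once. -/
def IsPointMatrix {F : Type*} [Field F] {k n : ℕ} (S : Set (ℙ F (Fin k → F)))
    (G : Matrix (Fin k) (Fin n) F) : Prop :=
  ∃ h : ∀ j, (fun i => G i j) ≠ 0,
    Function.Injective (fun j => Projectivization.mk F (fun i => G i j) (h j)) ∧
    Set.range (fun j => Projectivization.mk F (fun i => G i j) (h j)) = S

/-- The linear code spanned by the rows of `G`. -/
def rowCode {F : Type*} [Field F] {k n : ℕ} (G : Matrix (Fin k) (Fin n) F) :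
    Submodule F (Fin n → F) :=
  Submodule.span F (Set.range fun i : Fin k => fun j : Fin n => G i j)

/-- A linear code is projective if no coordinate vanishes identically on it and no two distinct
coordinates are proportional on it. -/
def IsProjectiveCode {F : Type*} [Field F] {n : ℕ} (C : Submodule F (Fin n → F)) : Prop :=
  (∀ j, ∃ c ∈ C, c j ≠ 0) ∧
    ∀ j k, j ≠ k → ∀ t : F, ∃ c ∈ C, c j ≠ t * c k

/-- `A_i`: the number of codewords of Hamming weight `i`. -/
noncomputable def weightCount {F : Type*} [Field F] [DecidableEq F] {n : ℕ}
    (C : Submodule F (Fin n → F)) (i : ℕ) : ℕ :=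
  Set.ncard {c : Fin n → F | c ∈ C ∧ hammingNorm c = i}

/-- The weight enumerator `∑ A_i x^i` (a weight is at most the length `n`). -/
noncomputable def weightEnumerator {F : Type*} [Field F] [DecidableEq F] {n : ℕ}
    (C : Submodule F (Fin n → F)) : Polynomial ℚ :=
  ∑ i ∈ Finset.range (n + 1), Polynomial.monomial i (weightCount C i : ℚ)

end FourWeightCode

/-! Let `φ` be `x ↦ x ^ q`, `K` its fixed field and `ε = b ^ q - b`, so that `φ ε = -ε` and every
element of `F` is uniquely `s + ε * u` with `s`, `u` in `K`. The condition on `a` and `b` says that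
`ε / (2 * a ^ q)` has norm 1, so by Hilbert 90 some `d ≠ 0` satisfies `φ d = ε / (2 * a ^ q) * d`.
In the coordinate `x_i = d * (s_i + ε * u_i)` the quadratic and Hermitian terms combine into a
perfect square, a multiple of `u_i ^ 2` (`exists_normalization`). The equation then only prescribes
the imaginary part of `x_r`, as `κ * ∑ u_i ^ 2` with `κ ≠ 0` in `K`; the `s_i`, the `u_i` and the
real part `y` stay free, which counts the points (`exists_affineSet_eq_range`).

Codewords correspond to linear forms, so the weight enumerator is a sum over forms
(`weightEnumerator_eq_sum`). A form without `X_r` is constant on the points or vanishes on an affine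
hyperplane in the other coordinates, times a free `y`. When `X_r` occurs, the real part of the
equation determines `y`. The imaginary part is linear in `s` unless the `s`-coefficients `w` all
vanish; in that case completing the square leaves `∑ u_i ^ 2 = c`, with `c` uniform over `K` as the
constant term varies. The weights thus rest on the number of representations by `r - 1` squares over
`K`, given by the quadratic character (`card_mul_sumSqCount_even`, `sumSqCount_odd`). Its dependence
on parity and on `χ (-1)` produces the cases. -/

namespace FourWeightCode

/-! ### Sums of squares and linear equations over a finite field -/

section Counting

variable {K : Type*} [Field K] [Fintype K] [DecidableEq K]

/-- The number of solutions of `u_1² + … + u_m² = c` over a finite field. -/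
def sumSqCount (m : ℕ) (c : K) : ℕ :=
  Finset.card {u : Fin m → K | ∑ i, u i ^ 2 = c}

theorem sumSqCount_zero (c : K) : sumSqCount 0 c = if c = 0 then 1 else 0 := by
  unfold sumSqCount
  split_ifs with h
  · subst h; simp
  · simp [Ne.symm h]

theorem sumSqCount_succ (m : ℕ) (c : K) :
    sumSqCount (m + 1) c = ∑ x : K, sumSqCount m (c - x ^ 2) := by
  unfold sumSqCount
  simp only [Finset.card_filter]
  rw [← (Fin.consEquiv (fun _ : Fin (m + 1) => K)).sum_comp, Fintype.sum_prod_type]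
  refine Finset.sum_congr rfl fun x _ => Finset.sum_congr rfl fun u _ => ?_
  simp [Fin.consEquiv, Fin.sum_univ_succ, eq_sub_iff_add_eq, add_comm]

theorem sum_sumSqCount (m : ℕ) : ∑ c : K, sumSqCount m c = Fintype.card K ^ m := by
  unfold sumSqCount
  rw [← Finset.card_eq_sum_card_fiberwise (s := Finset.univ) (t := Finset.univ)
    (f := fun u : Fin m → K => ∑ i, u i ^ 2) (by simp)]
  simp

theorem sum_sumSqCount_sub (m : ℕ) (c : K) :
    ∑ d : K, sumSqCount m (c - d) = Fintype.card K ^ m := by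
  rw [← sum_sumSqCount m]
  exact (Equiv.subLeft c).sum_comp (fun d => sumSqCount m d)

/-- Each `d` has `1 + χ d` square roots, which turns sums over squares into character sums. -/
theorem sum_apply_sq (hK : ringChar K ≠ 2) (f : K → ℤ) :
    ∑ x : K, f (x ^ 2) = ∑ d : K, (1 + quadraticChar K d) * f d := by
  rw [← Finset.sum_fiberwise Finset.univ (fun x : K => x ^ 2)]
  refine Finset.sum_congr rfl fun d _ => ?_
  rw [Finset.sum_congr rfl (g := fun _ => f d)
    (fun x hx => by rw [(Finset.mem_filter.1 hx).2]), Finset.sum_const, nsmul_eq_mul,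
    add_comm, ← quadraticChar_card_sqrts hK d]
  congr 3
  ext x; simp

theorem sumSqCount_one (hK : ringChar K ≠ 2) (c : K) :
    (sumSqCount 1 c : ℤ) = 1 + quadraticChar K c := by
  rw [sumSqCount_succ, Nat.cast_sum, sum_apply_sq hK (fun d => (sumSqCount 0 (c - d) : ℤ)),
    Finset.sum_eq_single c]
  · simp [sumSqCount_zero]
  · intro d _ hd
    simp [sumSqCount_zero, sub_eq_zero, Ne.symm hd]
  · simp

/-- For `c ≠ 0` the substitution `d ↦ c * d` pulls out `χ (c ^ 2) = 1` and leaves a Jacobi sum; for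
`c = 0` every nonzero `d` contributes `χ (-1)`. -/
theorem sum_quadraticChar_mul_sub (hK : ringChar K ≠ 2) (c : K) :
    ∑ d : K, quadraticChar K d * quadraticChar K (c - d)
      = (if c = 0 then (Fintype.card K : ℤ) else 0) * quadraticChar K (-1)
        - quadraticChar K (-1) := by
  by_cases hc : c = 0
  · subst hc
    have h : ∀ d : K, quadraticChar K d * quadraticChar K (0 - d)
        = quadraticChar K (-1) - if d = 0 then quadraticChar K (-1) else 0 := by
      intro d
      split_ifs with hd
      · simp [hd]
      · rw [← map_mul, show d * (0 - d) = -1 * d ^ 2 by ring, map_mul,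
          quadraticChar_sq_one' hd]
        ring
    rw [Finset.sum_congr rfl fun d _ => h d, Finset.sum_sub_distrib, Finset.sum_const,
      Finset.sum_ite_eq' Finset.univ (0 : K)]
    simp only [Finset.card_univ, nsmul_eq_mul, Finset.mem_univ, if_true]
  · rw [← Equiv.sum_comp (Equiv.mulLeft₀ c hc)]
    have h : ∀ d : K, quadraticChar K (c * d) * quadraticChar K (c - c * d)
        = quadraticChar K d * quadraticChar K (1 - d) := by
      intro d
      rw [← map_mul, ← map_mul, show c * d * (c - c * d) = c ^ 2 * (d * (1 - d)) by ring,
        map_mul, quadraticChar_sq_one' hc, one_mul]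
    have hJ := jacobiSum_nontrivial_inv (quadraticChar_ne_one hK)
    rw [(quadraticChar_isQuadratic K).inv] at hJ
    simp only [Equiv.mulLeft₀_apply, h, if_neg hc, zero_mul, zero_sub]
    exact hJ

theorem sumSqCount_two (hK : ringChar K ≠ 2) (c : K) :
    (sumSqCount 2 c : ℤ) = Fintype.card K
      + (if c = 0 then (Fintype.card K : ℤ) else 0) * quadraticChar K (-1)
        - quadraticChar K (-1) := by
  rw [sumSqCount_succ, Nat.cast_sum, sum_apply_sq hK (fun d => (sumSqCount 1 (c - d) : ℤ))]
  simp only [sumSqCount_one hK, add_mul, mul_add, one_mul, mul_one, Finset.sum_add_distrib]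
  rw [quadraticChar_sum_zero hK, sum_quadraticChar_mul_sub hK,
    show ∑ d : K, quadraticChar K (c - d) = ∑ d : K, quadraticChar K d from
      (Equiv.subLeft c).sum_comp (fun d => quadraticChar K d), quadraticChar_sum_zero hK]
  simp
  ring

/-- The count for two squares is constant away from `0`. Convolving with it therefore gives a
multiple of the total mass plus one term from `d = 0`, a two-step recursion for both parities. -/
theorem sumSqCount_add_two (hK : ringChar K ≠ 2) (m : ℕ) (c : K) :
    (sumSqCount (m + 2) c : ℤ)
      = (Fintype.card K - quadraticChar K (-1)) * Fintype.card K ^ m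
        + Fintype.card K * quadraticChar K (-1) * sumSqCount m c := by
  have h2 : ∀ f : K → ℤ, ∑ x : K, ∑ y : K, f (x ^ 2 + y ^ 2)
      = ∑ d : K, (sumSqCount 2 d : ℤ) * f d := by
    intro f
    have hu : ∀ d : K, (sumSqCount 2 d : ℤ)
        = ∑ x : K, ∑ y : K, if x ^ 2 + y ^ 2 = d then 1 else 0 := by
      intro d
      rw [sumSqCount_succ, Nat.cast_sum]
      refine Finset.sum_congr rfl fun x _ => ?_
      rw [sumSqCount_succ, Nat.cast_sum]
      refine Finset.sum_congr rfl fun y _ => ?_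
      rw [sumSqCount_zero, Nat.cast_ite]
      simp only [sub_sub, sub_eq_zero, eq_comm (a := d), Nat.cast_one, Nat.cast_zero]
    simp only [hu, Finset.sum_mul]
    symm
    rw [Finset.sum_comm]
    refine Finset.sum_congr rfl fun x _ => ?_
    rw [Finset.sum_comm]
    refine Finset.sum_congr rfl fun y _ => ?_
    simp
  have h := h2 fun d => (sumSqCount m (c - d) : ℤ)
  have hL : (sumSqCount (m + 2) c : ℤ)
      = ∑ x : K, ∑ y : K, (sumSqCount m (c - (x ^ 2 + y ^ 2)) : ℤ) := by
    rw [sumSqCount_succ, Nat.cast_sum]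
    refine Finset.sum_congr rfl fun x _ => ?_
    rw [sumSqCount_succ, Nat.cast_sum]
    simp only [sub_sub]
  have hS : ∑ d : K, (sumSqCount m (c - d) : ℤ) = (Fintype.card K : ℤ) ^ m := by
    exact_mod_cast sum_sumSqCount_sub m c
  rw [hL, h]
  simp only [sumSqCount_two hK, add_mul, sub_mul, Finset.sum_add_distrib,
    Finset.sum_sub_distrib, ← Finset.mul_sum, hS, ite_mul, zero_mul]
  simp
  ring

/-- The extra factor `Fintype.card K` avoids the exponent `k - 1`, so the induction can start at `k
= 0`. -/
theorem card_mul_sumSqCount_even (hK : ringChar K ≠ 2) (k : ℕ) (c : K) :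
    (Fintype.card K : ℤ) * sumSqCount (2 * k) c = Fintype.card K ^ (2 * k)
      + (Fintype.card K * quadraticChar K (-1)) ^ k
        * ((if c = 0 then (Fintype.card K : ℤ) else 0) - 1) := by
  induction k with
  | zero => simp [sumSqCount_zero]
  | succ k ih =>
    rw [show 2 * (k + 1) = 2 * k + 2 by ring, sumSqCount_add_two hK]
    linear_combination (Fintype.card K : ℤ) * quadraticChar K (-1) * ih

theorem sumSqCount_odd (hK : ringChar K ≠ 2) (k : ℕ) (c : K) :
    (sumSqCount (2 * k + 1) c : ℤ) = Fintype.card K ^ (2 * k)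
      + (Fintype.card K * quadraticChar K (-1)) ^ k * quadraticChar K c := by
  induction k with
  | zero => simp [sumSqCount_one hK]
  | succ k ih =>
    rw [show 2 * (k + 1) + 1 = 2 * k + 1 + 2 by ring, sumSqCount_add_two hK]
    linear_combination (Fintype.card K : ℤ) * quadraticChar K (-1) * ih

/-- Translation along a coordinate with nonzero coefficient matches any two fibres, so they share
the space equally. -/
theorem card_linear_fiber {m : ℕ} {γ : Fin (m + 1) → K} (hγ : γ ≠ 0) (c : K) :
    Finset.card {v : Fin (m + 1) → K | ∑ i, γ i * v i = c} = Fintype.card K ^ m := by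
  obtain ⟨i, hi⟩ := Function.ne_iff.1 hγ
  have hi : γ i ≠ 0 := hi
  have hfib : ∀ c', Finset.card {v : Fin (m + 1) → K | ∑ i, γ i * v i = c'}
      = Finset.card {v : Fin (m + 1) → K | ∑ i, γ i * v i = c} := by
    intro c'
    refine Finset.card_equiv (Equiv.addRight (Pi.single i ((c - c') / γ i))) fun v => ?_
    have : ∑ j, γ j * (v j + (Pi.single i ((c - c') / γ i) : Fin (m + 1) → K) j)
        = ∑ j, γ j * v j + (c - c') := by
      simp only [mul_add, Finset.sum_add_distrib]
      congr 1
      rw [Finset.sum_eq_single i]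
      · simp [mul_div_cancel₀ _ hi]
      · intro j _ hj; simp [hj]
      · simp
    simp only [Finset.mem_filter, Finset.mem_univ, true_and, Equiv.coe_addRight, Pi.add_apply,
      this]
    constructor
    · rintro rfl; ring
    · intro h; linear_combination h
  have hsum := Finset.card_eq_sum_card_fiberwise (s := Finset.univ) (t := Finset.univ)
    (f := fun u : Fin (m + 1) → K => ∑ i, γ i * u i) (by simp)
  simp only [hfib, Finset.sum_const, Finset.card_univ, Fintype.card_pi, Finset.prod_const,
    Fintype.card_fin, smul_eq_mul, pow_succ'] at hsum
  exact (Nat.eq_of_mul_eq_mul_left Fintype.card_pos hsum).symm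

end Counting

/-! ### Codes from point sets, and weights as counts over linear forms -/

section Codes

variable {F : Type*} [Field F] {k n : ℕ}

theorem mem_rowCode_iff {G : Matrix (Fin k) (Fin n) F} {c : Fin n → F} :
    c ∈ rowCode G ↔ ∃ α : Fin k → F, c = fun j => ∑ i, α i * G i j := by
  unfold rowCode
  rw [Submodule.mem_span_range_iff_exists_fun]
  refine exists_congr fun α => ?_
  rw [eq_comm]
  refine Eq.congr rfl ?_
  ext j
  simp

theorem row_mem_rowCode (G : Matrix (Fin k) (Fin n) F) (i : Fin k) :
    (fun j => G i j) ∈ rowCode G :=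
  Submodule.subset_span ⟨i, rfl⟩

theorem isProjectiveCode_rowCode {S : Set (ℙ F (Fin k → F))} {G : Matrix (Fin k) (Fin n) F}
    (hG : IsPointMatrix S G) : IsProjectiveCode (rowCode G) := by
  obtain ⟨h0, hinj, -⟩ := hG
  constructor
  · intro j
    obtain ⟨i, hi⟩ := Function.ne_iff.1 (h0 j)
    exact ⟨_, row_mem_rowCode G i, hi⟩
  · intro j l hjl t
    by_contra! hc
    refine hjl (hinj ?_)
    have hcol : (fun i => G i j) = t • fun i => G i l :=
      funext fun i => hc _ (row_mem_rowCode G i)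
    exact (Projectivization.mk_eq_mk_iff' F _ _ (h0 j) (h0 l)).2 ⟨t, hcol.symm⟩

/-- Vectors with first coordinate `1` are determined by their projective points. -/
theorem mk_injective_of_apply_zero_eq_one {x y : Fin (k + 1) → F} (hx : x ≠ 0) (hy : y ≠ 0)
    (hx0 : x 0 = 1) (hy0 : y 0 = 1)
    (h : Projectivization.mk F x hx = Projectivization.mk F y hy) : x = y := by
  obtain ⟨t, ht⟩ := (Projectivization.mk_eq_mk_iff' F _ _ hx hy).1 h
  have := congrFun ht 0
  simp only [Pi.smul_apply, hx0, hy0, smul_eq_mul, mul_one] at this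
  rw [← ht, this, one_smul]

variable {T : Type*} {pt : T → Fin (k + 1) → F}

/-- The normalisation `X_0 = 1` selects one vector per projective point, so the freedom in `G` is a
relabelling and nonzero column scalars, neither of which affects weights. -/
theorem IsPointMatrix.exists_equiv (hpt : Function.Injective pt) (h1 : ∀ τ, pt τ 0 = 1)
    {G : Matrix (Fin (k + 1)) (Fin n) F}
    (hG : IsPointMatrix {P | ∃ x, ∃ hx : x ≠ 0, x ∈ Set.range pt ∧
      P = Projectivization.mk F x hx} G) :
    ∃ (e : Fin n ≃ T) (s : Fin n → F), (∀ j, s j ≠ 0) ∧ ∀ i j, G i j = s j * pt (e j) i := by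
  obtain ⟨h0, hinj, hran⟩ := hG
  have hpt0 : ∀ τ, pt τ ≠ 0 := fun τ h => by simpa [h1] using congrFun h 0
  have hex : ∀ j, ∃ τ, ∃ s : F, s ≠ 0 ∧ (fun i => G i j) = s • pt τ := by
    intro j
    obtain ⟨x, hx, ⟨τ, rfl⟩, hP⟩ := hran.le ⟨j, rfl⟩
    obtain ⟨s, hs⟩ := (Projectivization.mk_eq_mk_iff' F _ _ (h0 j) hx).1 hP
    refine ⟨τ, s, ?_, hs.symm⟩
    rintro rfl
    exact h0 j (by rw [← hs, zero_smul])
  choose e s hs hes using hex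
  have hmk : ∀ j, Projectivization.mk F (fun i => G i j) (h0 j)
      = Projectivization.mk F (pt (e j)) (hpt0 _) := fun j =>
    (Projectivization.mk_eq_mk_iff' F _ _ (h0 j) (hpt0 _)).2 ⟨s j, (hes j).symm⟩
  have hbij : Function.Bijective e := by
    constructor
    · intro j l hjl
      refine hinj ?_
      simp only [hmk, hjl]
    · intro τ
      obtain ⟨j, hj⟩ := hran.ge ⟨pt τ, hpt0 τ, ⟨τ, rfl⟩, rfl⟩
      refine ⟨j, hpt (mk_injective_of_apply_zero_eq_one (hpt0 _) (hpt0 _) (h1 _) (h1 _) ?_)⟩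
      rw [← hmk]
      exact hj
  refine ⟨Equiv.ofBijective e hbij, s, hs, fun i j => ?_⟩
  simpa using congrFun (hes j) i

theorem exists_isPointMatrix [Fintype T] (hpt : Function.Injective pt) (h1 : ∀ τ, pt τ 0 = 1)
    (hn : Fintype.card T = n) :
    ∃ G : Matrix (Fin (k + 1)) (Fin n) F,
      IsPointMatrix {P | ∃ x, ∃ hx : x ≠ 0, x ∈ Set.range pt ∧
        P = Projectivization.mk F x hx} G := by
  have hpt0 : ∀ τ, pt τ ≠ 0 := fun τ h => by simpa [h1] using congrFun h 0
  let e : Fin n ≃ T := (finCongr hn.symm).trans (Fintype.equivFin T).symm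
  refine ⟨fun i j => pt (e j) i, fun j => hpt0 (e j), ?_, ?_⟩
  · intro j l h
    exact e.injective (hpt (mk_injective_of_apply_zero_eq_one _ _ (h1 _) (h1 _) h))
  · ext P
    constructor
    · rintro ⟨j, rfl⟩
      exact ⟨pt (e j), hpt0 _, ⟨e j, rfl⟩, rfl⟩
    · rintro ⟨_, hx, ⟨τ, rfl⟩, rfl⟩
      exact ⟨e.symm τ, by simp⟩

theorem encoder_injective {pt : T → Fin k → F} {G : Matrix (Fin k) (Fin n) F}
    (e : Fin n ≃ T) (s : Fin n → F) (hs : ∀ j, s j ≠ 0) (hG : ∀ i j, G i j = s j * pt (e j) i)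
    (hspan : ∀ α : Fin k → F, (∀ τ, ∑ i, α i * pt τ i = 0) → α = 0) :
    Function.Injective (Fintype.linearCombination F (fun i j => G i j)) := by
  rw [← LinearMap.ker_eq_bot, LinearMap.ker_eq_bot']
  intro α hα
  refine hspan α fun τ => ?_
  have h := congrFun hα (e.symm τ)
  simp only [Fintype.linearCombination_apply, Finset.sum_apply, Pi.smul_apply, smul_eq_mul, hG,
    Equiv.apply_symm_apply, Pi.zero_apply] at h
  refine (mul_eq_zero.1 ?_).resolve_left (hs (e.symm τ))
  rw [← h, Finset.mul_sum]
  exact Finset.sum_congr rfl fun i _ => by ring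

theorem finrank_rowCode {G : Matrix (Fin k) (Fin n) F}
    (hinj : Function.Injective (Fintype.linearCombination F (fun i j => G i j))) :
    Module.finrank F (rowCode G) = k := by
  have hli : LinearIndependent F (fun i : Fin k => fun j => G i j) := by
    refine Fintype.linearIndependent_iff.2 fun g hg => congrFun (hinj (a₂ := 0) ?_)
    rw [map_zero, Fintype.linearCombination_apply]
    exact hg
  exact (finrank_span_eq_card hli).trans (Fintype.card_fin k)

variable [DecidableEq F] [Fintype T]

/-- The number of points on which the linear form `α` does not vanish. -/
def formWeight (pt : T → Fin k → F) (α : Fin k → F) : ℕ :=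
  Finset.card {τ | ∑ i, α i * pt τ i ≠ 0}

theorem hammingNorm_eq_formWeight {pt : T → Fin k → F} {G : Matrix (Fin k) (Fin n) F}
    (e : Fin n ≃ T) (s : Fin n → F) (hs : ∀ j, s j ≠ 0) (hG : ∀ i j, G i j = s j * pt (e j) i)
    (α : Fin k → F) :
    hammingNorm (fun j => ∑ i, α i * G i j) = formWeight pt α := by
  unfold hammingNorm formWeight
  refine Finset.card_equiv e fun j => ?_
  have : ∑ i, α i * G i j = s j * ∑ i, α i * pt (e j) i := by
    rw [Finset.mul_sum]
    exact Finset.sum_congr rfl fun i _ => by rw [hG]; ring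
  simp [this, hs j]

/-- Since no nonzero form vanishes on all points, each codeword comes from exactly one form. -/
theorem weightEnumerator_eq_sum [Fintype F] {pt : T → Fin k → F} {G : Matrix (Fin k) (Fin n) F}
    (e : Fin n ≃ T) (s : Fin n → F) (hs : ∀ j, s j ≠ 0) (hG : ∀ i j, G i j = s j * pt (e j) i)
    (hspan : ∀ α : Fin k → F, (∀ τ, ∑ i, α i * pt τ i = 0) → α = 0) :
    weightEnumerator (rowCode G)
      = ∑ α : Fin k → F, Polynomial.monomial (formWeight pt α) (1 : ℚ) := by
  have hinj := encoder_injective e s hs hG hspan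
  have hcount : ∀ i, weightCount (rowCode G) i
      = Finset.card {α : Fin k → F | formWeight pt α = i} := by
    intro i
    have himg : {c : Fin n → F | c ∈ rowCode G ∧ hammingNorm c = i}
        = (Fintype.linearCombination F (fun i j => G i j)) ''
          (({α : Fin k → F | formWeight pt α = i} : Finset (Fin k → F)) : Set (Fin k → F)) := by
      have hlc : ∀ α : Fin k → F, Fintype.linearCombination F (fun i j => G i j) α
          = fun j => ∑ i, α i * G i j := by
        intro α; ext j; simp [Fintype.linearCombination_apply]
      ext c
      simp only [Set.mem_ofPred_eq, mem_rowCode_iff, Set.mem_image, Finset.coe_filter,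
        Finset.mem_univ, true_and, hlc]
      constructor
      · rintro ⟨⟨α, rfl⟩, h⟩
        exact ⟨α, by rw [← h, hammingNorm_eq_formWeight e s hs hG], rfl⟩
      · rintro ⟨α, h, rfl⟩
        exact ⟨⟨α, rfl⟩, by rw [← h, hammingNorm_eq_formWeight e s hs hG]⟩
    rw [weightCount, himg, Set.ncard_image_of_injective _ hinj, Set.ncard_coe_finset]
  -- No form is lost by truncating the enumerator at degree `n`.
  have hle : ∀ α : Fin k → F, formWeight pt α ∈ Finset.range (n + 1) := by
    intro α
    rw [Finset.mem_range, Nat.lt_succ_iff, ← hammingNorm_eq_formWeight e s hs hG]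
    simpa using hammingNorm_le_card_fintype (x := fun j => ∑ i, α i * G i j)
  rw [weightEnumerator, ← Finset.sum_fiberwise_of_maps_to (fun α _ => hle α)]
  refine Finset.sum_congr rfl fun i _ => ?_
  rw [hcount, Finset.sum_congr rfl (g := fun _ => Polynomial.monomial i (1 : ℚ))
    (fun α hα => by rw [(Finset.mem_filter.1 hα).2]), Finset.sum_const, ← map_nsmul]
  simp

theorem coeff_weightEnumerator {C : Submodule F (Fin n → F)} (i : ℕ) :
    (weightEnumerator C).coeff i = (weightCount C i : ℚ) := by
  rw [weightEnumerator, Polynomial.finsetSum_coeff]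
  simp only [Polynomial.coeff_monomial, Finset.sum_ite_eq', Finset.mem_range]
  split_ifs with h
  · rfl
  · symm
    rw [Nat.cast_eq_zero, weightCount]
    refine (congrArg Set.ncard ?_).trans (Set.ncard_empty _)
    refine Set.ext fun c => ?_
    simp only [Set.mem_ofPred_eq, Set.mem_empty_iff_false, iff_false, not_and]
    rintro - rfl
    exact h (Nat.lt_succ_of_le (by simpa using hammingNorm_le_card_fintype (x := c)))

/-- The strict ordering of the exponents prevents monomials from merging, so each coefficient can be
read off. -/
theorem four_weights_of_weightEnumerator {C : Submodule F (Fin n → F)} {w₀ w₁ w₂ w₃ : ℕ}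
    {A₀ A₁ A₂ A₃ : ℚ}
    (hw : weightEnumerator C = Polynomial.monomial 0 1 + Polynomial.monomial w₀ A₀
      + Polynomial.monomial w₁ A₁ + Polynomial.monomial w₂ A₂ + Polynomial.monomial w₃ A₃)
    (hA₀ : A₀ ≠ 0) (hA₁ : A₁ ≠ 0) (hA₂ : A₂ ≠ 0) (hA₃ : A₃ ≠ 0)
    (h1 : 0 < w₁) (h12 : w₁ < w₂) (h23 : w₂ < w₃) (h30 : w₃ < w₀) :
    (weightCount C w₀ : ℚ) = A₀ ∧ {i : ℕ | i ≠ 0 ∧ weightCount C i ≠ 0}.ncard = 4 := by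
  have hcoeff : ∀ i, (weightCount C i : ℚ) = (if 0 = i then 1 else 0)
      + (if w₀ = i then A₀ else 0) + (if w₁ = i then A₁ else 0) + (if w₂ = i then A₂ else 0)
      + (if w₃ = i then A₃ else 0) := by
    intro i
    rw [← coeff_weightEnumerator, hw]
    simp only [Polynomial.coeff_add, Polynomial.coeff_monomial]
  constructor
  · rw [hcoeff, if_neg (by omega), if_pos rfl, if_neg (by omega), if_neg (by omega),
      if_neg (by omega)]
    ring
  · have hset : {i : ℕ | i ≠ 0 ∧ weightCount C i ≠ 0}
        = (({w₀, w₁, w₂, w₃} : Finset ℕ) : Set ℕ) := by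
      ext i
      simp only [Set.mem_ofPred_eq, ← Nat.cast_ne_zero (R := ℚ), hcoeff i, Finset.coe_insert,
        Finset.coe_singleton, Set.mem_insert_iff, Set.mem_singleton_iff]
      constructor
      · rintro ⟨hi, h⟩
        by_contra! hne
        obtain ⟨g0, g1, g2, g3⟩ := hne
        refine h ?_
        rw [if_neg (by rintro rfl; exact hi rfl), if_neg g0.symm, if_neg g1.symm,
          if_neg g2.symm, if_neg g3.symm]
        ring
      · rintro (rfl | rfl | rfl | rfl)
        · refine ⟨by simp; omega, ?_⟩
          rwa [if_neg (by omega), if_pos rfl, if_neg (by omega), if_neg (by omega),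
            if_neg (by omega), zero_add, add_zero, add_zero, add_zero]
        · refine ⟨by simp; omega, ?_⟩
          rwa [if_neg (by omega), if_neg (by omega), if_pos rfl, if_neg (by omega),
            if_neg (by omega), zero_add, zero_add, add_zero, add_zero]
        · refine ⟨by simp; omega, ?_⟩
          rwa [if_neg (by omega), if_neg (by omega), if_neg (by omega), if_pos rfl,
            if_neg (by omega), zero_add, zero_add, zero_add, add_zero]
        · refine ⟨by simp; omega, ?_⟩
          rwa [if_neg (by omega), if_neg (by omega), if_neg (by omega), if_neg (by omega),
            if_pos rfl, zero_add, zero_add, zero_add, zero_add]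
    rw [hset, Set.ncard_coe_finset, Finset.card_insert_of_notMem, Finset.card_insert_of_notMem,
      Finset.card_insert_of_notMem, Finset.card_singleton]
    all_goals simp only [Finset.mem_insert, Finset.mem_singleton]; omega

end Codes

/-! ### Parametrisation over the subfield, and zeros of linear forms -/

section Parametrisation

variable {F : Type*} [Field F] {K : Subfield F} {m : ℕ}

/-- The vector `(1, d (s_1 + ε u_1), …, d (s_m + ε u_m), y + ε κ ∑ u_i²)`. -/
def coordPoint (ε d : F) (κ : K) (τ : (Fin m → K) × (Fin m → K) × K) : Fin (m + 1 + 1) → F :=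
  Fin.cons 1 (Fin.snoc (fun i => d * ((τ.1 i : F) + ε * τ.2.1 i))
    ((τ.2.2 : F) + ε * (κ * ∑ i, (τ.2.1 i : F) ^ 2) : F) : Fin (m + 1) → F)

/-- The coefficient vector of the linear form `α₀ X₀ + ∑ α_i X_i + t X_r`. -/
def linearForm (α₀ : F) (α : Fin m → F) (t : F) : Fin (m + 1 + 1) → F :=
  Fin.cons α₀ (Fin.snoc α t : Fin (m + 1) → F)

theorem sum_linearForm_mul_coordPoint (ε d : F) (κ : K) (α₀ : F) (α : Fin m → F) (t : F)
    (τ : (Fin m → K) × (Fin m → K) × K) :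
    ∑ i, linearForm α₀ α t i * coordPoint ε d κ τ i
      = α₀ + ∑ i, α i * (d * ((τ.1 i : F) + ε * τ.2.1 i))
        + t * (τ.2.2 + ε * (κ * ∑ i, (τ.2.1 i : F) ^ 2)) := by
  simp only [linearForm, coordPoint]
  rw [Fin.sum_univ_succ, Fin.sum_univ_castSucc]
  simp [add_assoc]

theorem exists_eq_linearForm (α : Fin (m + 1 + 1) → F) :
    α = linearForm (α 0) (fun i => α i.castSucc.succ) (α (Fin.last (m + 1))) := by
  funext i
  refine Fin.cases ?_ (fun i => ?_) i
  · simp [linearForm]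
  · refine Fin.lastCases ?_ (fun i => ?_) i
    · simp [linearForm]
    · simp [linearForm]

theorem sum_linearForm [Fintype F] {M : Type*} [AddCommMonoid M]
    (g : (Fin (m + 1 + 1) → F) → M) :
    ∑ α, g α = ∑ t : F, ∑ α : Fin m → F, ∑ α₀ : F, g (linearForm α₀ α t) := by
  let e : F × (Fin m → F) × F ≃ (Fin (m + 1 + 1) → F) :=
    { toFun := fun p => linearForm p.2.2 p.2.1 p.1
      invFun := fun α => (α (Fin.last (m + 1)), fun i => α i.castSucc.succ, α 0)
      left_inv := fun p => by simp [linearForm, ← Fin.succ_last]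
      right_inv := fun α => (exists_eq_linearForm α).symm }
  rw [← e.sum_comp, Fintype.sum_prod_type]
  refine Finset.sum_congr rfl fun t _ => ?_
  rw [Fintype.sum_prod_type]
  rfl

/-- The origin, the point with `y = 1` and the points with one `s_i = 1` isolate the coefficients
one at a time. -/
theorem eq_zero_of_forall_coordPoint {ε d : F} (hd : d ≠ 0) (κ : K) (α : Fin (m + 1 + 1) → F)
    (h : ∀ τ, ∑ i, α i * coordPoint ε d κ τ i = 0) : α = 0 := by
  rw [exists_eq_linearForm α] at h ⊢
  generalize α 0 = α₀ at *
  generalize α (Fin.last (m + 1)) = t at *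
  generalize (fun i => α (Fin.succ (Fin.castSucc i))) = β at *
  simp only [sum_linearForm_mul_coordPoint] at h
  have h0 : α₀ = 0 := by simpa using h (0, 0, 0)
  have ht : t = 0 := by simpa [h0] using h (0, 0, 1)
  have hβ : β = 0 := by
    funext i
    have := h (Pi.single i 1, 0, 0)
    simp only [h0, ht] at this
    rw [Finset.sum_eq_single i] at this
    · simpa [hd] using this
    · intro j _ hj; simp [hj]
    · simp
  subst h0 ht hβ
  funext i
  refine Fin.cases ?_ (fun i => ?_) i
  · simp [linearForm]
  · refine Fin.lastCases ?_ (fun i => ?_) i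
    · simp [linearForm]
    · simp [linearForm]

/-- Rational scalars make `card - 1` a true subtraction, so that multiplicities can be handled by
`module`. -/
theorem sum_eq_apply_add_smul {ι M : Type*} [Fintype ι] [DecidableEq ι] [AddCommGroup M]
    [Module ℚ M] (x₀ : ι) (f : ι → M) (c : M) (h : ∀ x, x ≠ x₀ → f x = c) :
    ∑ x, f x = f x₀ + ((Fintype.card ι : ℚ) - 1) • c := by
  rw [← Finset.add_sum_erase _ _ (Finset.mem_univ x₀),
    Finset.sum_congr rfl fun x hx => h x (Finset.ne_of_mem_erase hx), Finset.sum_const,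
    Finset.card_erase_of_mem (Finset.mem_univ _), Finset.card_univ, ← Nat.cast_smul_eq_nsmul ℚ,
    Nat.cast_sub (Fintype.card_pos_iff.2 ⟨x₀⟩), Nat.cast_one]

theorem card_eq_of_bijective [Fintype F] [Fintype K] {ε : F}
    (hbij : Function.Bijective fun p : K × K => (p.1 : F) + ε * p.2) :
    Fintype.card F = Fintype.card K ^ 2 := by
  rw [← Fintype.card_of_bijective hbij, Fintype.card_prod, sq]

theorem card_coordinates [Fintype K] :
    Fintype.card ((Fin m → K) × (Fin m → K) × K) = Fintype.card K ^ (2 * m + 1) := by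
  simp only [Fintype.card_prod, Fintype.card_pi, Finset.prod_const, Finset.card_univ,
    Fintype.card_fin]
  ring

variable [DecidableEq F]

theorem formWeight_add_card {k : ℕ} {T : Type*} [Fintype T] (pt : T → Fin k → F)
    (α : Fin k → F) :
    formWeight pt α + Finset.card {τ | ∑ i, α i * pt τ i = 0} = Fintype.card T := by
  rw [formWeight, add_comm]
  exact Finset.card_filter_add_card_filter_not _

variable [Fintype K] {ε d : F} {κ : K}

theorem formWeight_zero : formWeight (coordPoint (m := m) ε d κ) (linearForm 0 0 0) = 0 := by
  simp [formWeight, sum_linearForm_mul_coordPoint]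

theorem formWeight_const {α₀ : F} (h : α₀ ≠ 0) :
    formWeight (coordPoint (m := m) ε d κ) (linearForm α₀ 0 0)
      = Fintype.card K ^ (2 * m + 1) := by
  simp [formWeight, sum_linearForm_mul_coordPoint, h, ← card_coordinates (K := K) (m := m)]

/-- Without `X_r` the coordinate `y` is free, and the `s_i + ε * u_i` run over all vectors over `F`;
the zeros are an affine hyperplane times `K`. -/
theorem formWeight_of_ne_zero [Fintype F]
    (hbij : Function.Bijective fun p : K × K => (p.1 : F) + ε * p.2)
    (hd : d ≠ 0) (α₀ : F) {α : Fin (m + 1) → F}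
    (hα : α ≠ 0) :
    formWeight (coordPoint ε d κ) (linearForm α₀ α 0)
      = Fintype.card K ^ (2 * m + 3) - Fintype.card K ^ (2 * m + 1) := by
  have h := formWeight_add_card (coordPoint ε d κ) (linearForm α₀ α 0)
  let E : ((Fin (m + 1) → K) × (Fin (m + 1) → K) × K) ≃ (Fin (m + 1) → F) × K :=
    (Equiv.prodAssoc _ _ _).symm.trans (Equiv.prodCongr
      ((Equiv.arrowProdEquivProdArrow _ _ _).symm.trans
        (Equiv.arrowCongr (Equiv.refl _) (Equiv.ofBijective _ hbij))) (Equiv.refl _))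
  have hz : Finset.card {τ : (Fin (m + 1) → K) × (Fin (m + 1) → K) × K |
      ∑ i, linearForm α₀ α 0 i * coordPoint ε d κ τ i = 0}
      = Fintype.card K ^ (2 * m + 1) := by
    have hγ : (fun i => α i * d) ≠ 0 := by
      obtain ⟨i, hi⟩ := Function.ne_iff.1 hα
      exact Function.ne_iff.2 ⟨i, mul_ne_zero hi hd⟩
    rw [Finset.card_equiv E (t := ({v : Fin (m + 1) → F | ∑ i, (α i * d) * v i = -α₀} :
      Finset (Fin (m + 1) → F)) ×ˢ (Finset.univ : Finset K))]
    · rw [Finset.card_product, card_linear_fiber hγ, card_eq_of_bijective hbij, Finset.card_univ]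
      ring
    · rintro ⟨s, u, y⟩
      simp only [Finset.mem_filter, Finset.mem_univ, true_and, Finset.mem_product, and_true,
        sum_linearForm_mul_coordPoint, zero_mul, add_zero, eq_neg_iff_add_eq_zero]
      rw [add_comm α₀]
      simp only [mul_assoc]
      rfl
  rw [hz, card_coordinates] at h
  exact Nat.eq_sub_of_add_eq h

/-- The number of zeros of the imaginary part of a linear form restricted to the point set. -/
theorem card_imaginary (w₀ : K) (p w : Fin (m + 1) → K) (hw : w ≠ 0) :
    Finset.card {x : (Fin (m + 1) → K) × (Fin (m + 1) → K) |
      w₀ + ∑ i, (p i * x.2 i + w i * x.1 i) = κ * ∑ i, x.2 i ^ 2}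
      = Fintype.card K ^ (2 * m + 1) := by
  rw [Finset.card_filter, Fintype.sum_prod_type_right]
  -- For fixed `u` the condition is one nontrivial linear equation in `s`.
  have h : ∀ u : Fin (m + 1) → K, (∑ s : Fin (m + 1) → K,
      if w₀ + ∑ i, (p i * u i + w i * s i) = κ * ∑ i, u i ^ 2 then 1 else 0)
      = Fintype.card K ^ m := by
    intro u
    rw [← card_linear_fiber hw (κ * ∑ i, u i ^ 2 - w₀ - ∑ i, p i * u i), ← Finset.card_filter]
    congr 1
    ext s
    simp only [Finset.mem_filter, Finset.mem_univ, true_and, Finset.sum_add_distrib]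
    constructor
    · intro h; linear_combination h
    · intro h; linear_combination h
  rw [Finset.sum_congr rfl fun u _ => h u]
  simp only [Finset.sum_const, Finset.card_univ, Fintype.card_pi, Finset.prod_const,
    Fintype.card_fin, smul_eq_mul]
  ring

/-- Here `s` is free, and completing the square by the shift `p i / (2 * κ)` leaves a pure sum of
squares in `u`. -/
theorem card_imaginary_zero (h2 : (2 : K) ≠ 0) (hκ : κ ≠ 0) (w₀ : K) (p : Fin m → K) :
    Finset.card {x : (Fin m → K) × (Fin m → K) |
      w₀ + ∑ i, (p i * x.2 i + (0 : Fin m → K) i * x.1 i) = κ * ∑ i, x.2 i ^ 2}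
      = Fintype.card K ^ m * sumSqCount m (w₀ / κ + ∑ i, (p i / (2 * κ)) ^ 2) := by
  rw [Finset.card_filter, Fintype.sum_prod_type, sumSqCount]
  have h : ∀ s : Fin m → K, (∑ u : Fin m → K,
      if w₀ + ∑ i, (p i * u i + (0 : Fin m → K) i * s i) = κ * ∑ i, u i ^ 2 then 1 else 0)
      = Finset.card {u : Fin m → K | ∑ i, u i ^ 2 = w₀ / κ + ∑ i, (p i / (2 * κ)) ^ 2} := by
    intro s
    rw [← Finset.card_filter]
    refine Finset.card_equiv (Equiv.subRight fun i => p i / (2 * κ)) fun u => ?_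
    simp only [Finset.mem_filter, Finset.mem_univ, true_and, Equiv.subRight_apply, Pi.sub_apply,
      Pi.zero_apply, zero_mul, add_zero]
    have hsq : ∑ i, (u i - p i / (2 * κ)) ^ 2
        = ∑ i, u i ^ 2 - (∑ i, p i * u i) / κ + ∑ i, (p i / (2 * κ)) ^ 2 := by
      rw [Finset.sum_div, ← Finset.sum_sub_distrib, ← Finset.sum_add_distrib]
      refine Finset.sum_congr rfl fun i _ => ?_
      field_simp
      ring
    rw [hsq]
    constructor
    · intro h
      have : ∑ i, u i ^ 2 = w₀ / κ + (∑ i, p i * u i) / κ := by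
        field_simp
        linear_combination -h
      rw [this]; ring
    · intro h
      have : ∑ i, u i ^ 2 = w₀ / κ + (∑ i, p i * u i) / κ := by linear_combination h
      rw [this]
      field_simp
  rw [Finset.sum_congr rfl fun s _ => h s]
  simp

/-- Dividing by `t` and absorbing `d` solves the form for `x_r`. The real part of the resulting
equation is met by exactly one `y`, so only the imaginary part restricts `(s, u)`. -/
theorem card_zeros_eq_card_imaginary
    (hbij : Function.Bijective fun p : K × K => (p.1 : F) + ε * p.2)
    {δ : K} (hδ : (δ : F) = ε ^ 2) (hd : d ≠ 0) {t : F}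
    (ht : t ≠ 0) (z₀ : K × K) (p w : Fin m → K) :
    Finset.card {τ : (Fin m → K) × (Fin m → K) × K |
      ∑ i, linearForm (-t * ((z₀.1 : F) + ε * z₀.2))
        (fun i => -t / d * ((p i : F) + ε * w i)) t i * coordPoint ε d κ τ i = 0}
    = Finset.card {x : (Fin m → K) × (Fin m → K) |
      z₀.2 + ∑ i, (p i * x.2 i + w i * x.1 i) = κ * ∑ i, x.2 i ^ 2} := by
  have key : ∀ τ : (Fin m → K) × (Fin m → K) × K,
      ∑ i, linearForm (-t * ((z₀.1 : F) + ε * z₀.2))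
        (fun i => -t / d * ((p i : F) + ε * w i)) t i * coordPoint ε d κ τ i = 0 ↔
      τ.2.2 = z₀.1 + ∑ i, (p i * τ.1 i + δ * (w i * τ.2.1 i)) ∧
      z₀.2 + ∑ i, (p i * τ.2.1 i + w i * τ.1 i) = κ * ∑ i, τ.2.1 i ^ 2 := by
    rintro ⟨s, u, y⟩
    have h1 : ∑ i, linearForm (-t * ((z₀.1 : F) + ε * z₀.2))
        (fun i => -t / d * ((p i : F) + ε * w i)) t i * coordPoint ε d κ (s, u, y) i
        = t * (((y : F) + ε * (κ * ∑ i, (u i : F) ^ 2))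
          - (((z₀.1 + ∑ i, (p i * s i + δ * (w i * u i)) : K) : F)
            + ε * ((z₀.2 + ∑ i, (p i * u i + w i * s i) : K) : F))) := by
      rw [sum_linearForm_mul_coordPoint]
      have : ∑ i, -t / d * ((p i : F) + ε * w i) * (d * ((s i : F) + ε * u i))
          = -t * ((∑ i, ((p i : F) * s i + δ * (w i * u i)))
            + ε * ∑ i, ((p i : F) * u i + w i * s i)) := by
        rw [Finset.mul_sum (a := ε), ← Finset.sum_add_distrib, Finset.mul_sum]
        refine Finset.sum_congr rfl fun i _ => ?_
        rw [hδ]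
        field_simp
        ring
      simp only [this]
      push_cast
      ring
    rw [h1, mul_eq_zero, or_iff_right ht, sub_eq_zero]
    constructor
    · intro h
      have h' := @hbij.1 (y, κ * ∑ i, u i ^ 2) (z₀.1 + ∑ i, (p i * s i + δ * (w i * u i)),
        z₀.2 + ∑ i, (p i * u i + w i * s i)) (by push_cast at h ⊢; exact h)
      exact ⟨(Prod.ext_iff.1 h').1, (Prod.ext_iff.1 h').2.symm⟩
    · rintro ⟨h', h⟩
      dsimp only at h' h
      rw [h', h]
      push_cast
      rfl
  simp only [key]
  refine Finset.card_nbij' (fun τ => (τ.1, τ.2.1))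
    (fun x => (x.1, x.2, z₀.1 + ∑ i, (p i * x.1 i + δ * (w i * x.2 i)))) ?_ ?_ ?_ ?_
  · intro τ hτ
    simpa using (by simpa using hτ : _ ∧ _).2
  · intro x hx
    simpa using hx
  · rintro ⟨s, u, y⟩ hτ
    have : y = z₀.1 + ∑ i, (p i * s i + δ * (w i * u i)) := by
      simpa using (by simpa using hτ : _ ∧ _).1
    simp [this]
  · intro x _
    rfl

end Parametrisation

/-! ### Summing over all linear forms -/

section Enumeration

variable {F : Type*} [Field F] [DecidableEq F] {K : Subfield F} [Fintype K] {k : ℕ}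
  {ε d : F} {κ δ : K}

theorem formWeight_of_last_ne_zero
    (hbij : Function.Bijective fun p : K × K => (p.1 : F) + ε * p.2)
    (hδ : (δ : F) = ε ^ 2) (hd : d ≠ 0) {t : F} (ht : t ≠ 0) (z₀ : K × K)
    (p : Fin (k + 1) → K) {w : Fin (k + 1) → K} (hw : w ≠ 0) :
    formWeight (coordPoint ε d κ) (linearForm (-t * ((z₀.1 : F) + ε * z₀.2))
        (fun i => -t / d * ((p i : F) + ε * w i)) t)
      = Fintype.card K ^ (2 * k + 3) - Fintype.card K ^ (2 * k + 1) := by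
  have h := formWeight_add_card (coordPoint ε d κ) (linearForm (-t * ((z₀.1 : F) + ε * z₀.2))
        (fun i => -t / d * ((p i : F) + ε * w i)) t)
  rw [card_zeros_eq_card_imaginary hbij hδ hd ht, card_imaginary _ _ _ hw,
    card_coordinates] at h
  exact Nat.eq_sub_of_add_eq h

theorem formWeight_of_last_ne_zero_of_real
    (hbij : Function.Bijective fun p : K × K => (p.1 : F) + ε * p.2) (h2 : (2 : K) ≠ 0)
    (hδ : (δ : F) = ε ^ 2) (hd : d ≠ 0) (hκ : κ ≠ 0) {t : F} (ht : t ≠ 0) (z₀ : K × K)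
    (p : Fin (k + 1) → K) :
    formWeight (coordPoint ε d κ) (linearForm (-t * ((z₀.1 : F) + ε * z₀.2))
        (fun i => -t / d * ((p i : F) + ε * (0 : Fin (k + 1) → K) i)) t)
      = Fintype.card K ^ (2 * k + 3) - Fintype.card K ^ (k + 1)
        * sumSqCount (k + 1) (z₀.2 / κ + ∑ i, (p i / (2 * κ)) ^ 2) := by
  have h := formWeight_add_card (coordPoint ε d κ) (linearForm (-t * ((z₀.1 : F) + ε * z₀.2))
        (fun i => -t / d * ((p i : F) + ε * (0 : Fin (k + 1) → K) i)) t)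
  rw [card_zeros_eq_card_imaginary hbij hδ hd ht, card_imaginary_zero h2 hκ,
    card_coordinates] at h
  exact Nat.eq_sub_of_add_eq h

variable [Fintype F]

/-- Coefficients are rewritten as pairs over `K`, with `z` for the constant term and `(p, w)` for
the middle ones. The case `w = 0` leaves `p` and the real part of `z` as pure multiplicity; for `w ≠
0` the weight is constant. -/
theorem sum_linearForm_of_last_ne_zero
    (hbij : Function.Bijective fun p : K × K => (p.1 : F) + ε * p.2) (h2 : (2 : K) ≠ 0)
    (hδ : (δ : F) = ε ^ 2) (hd : d ≠ 0) (hκ : κ ≠ 0) {t : F} (ht : t ≠ 0)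
    {M : Type*} [AddCommGroup M] [Module ℚ M] (g : ℕ → M) :
    ∑ α : Fin (k + 1) → F, ∑ α₀ : F, g (formWeight (coordPoint ε d κ) (linearForm α₀ α t))
      = (Fintype.card K : ℚ) ^ (k + 2) • ∑ c : K,
          g (Fintype.card K ^ (2 * k + 3) - Fintype.card K ^ (k + 1) * sumSqCount (k + 1) c)
        + ((Fintype.card K : ℚ) ^ (2 * k + 4) - (Fintype.card K : ℚ) ^ (k + 3)) •
          g (Fintype.card K ^ (2 * k + 3) - Fintype.card K ^ (2 * k + 1)) := by
  have hEt : ∀ x : F, x ≠ 0 →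
      Function.Bijective fun p : K × K => x * ((p.1 : F) + ε * p.2) := fun x hx =>
    (Equiv.mulLeft₀ x hx).bijective.comp hbij
  have ht' : -t ≠ 0 := neg_ne_zero.2 ht
  let E₀ : K × K ≃ F := Equiv.ofBijective _ (hEt (-t) ht')
  let E : (Fin (k + 1) → K) × (Fin (k + 1) → K) ≃ (Fin (k + 1) → F) :=
    (Equiv.arrowProdEquivProdArrow _ _ _).symm.trans
      (Equiv.arrowCongr (Equiv.refl _) (Equiv.ofBijective _ (hEt (-t / d) (div_ne_zero ht' hd))))
  rw [← E.sum_comp, Finset.sum_congr rfl fun x _ => (E₀.sum_comp _).symm]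
  have hE : ∀ x z, linearForm (E₀ z) (E x) t = linearForm (-t * ((z.1 : F) + ε * z.2))
        (fun i => -t / d * ((x.1 i : F) + ε * x.2 i)) t := fun _ _ => rfl
  simp only [hE]
  rw [Fintype.sum_prod_type]
  have hp : ∀ p : Fin (k + 1) → K, (∑ w : Fin (k + 1) → K, ∑ z : K × K,
      g (formWeight (coordPoint ε d κ) (linearForm (-t * ((z.1 : F) + ε * z.2))
        (fun i => -t / d * ((p i : F) + ε * w i)) t)))
      = (Fintype.card K : ℚ) • ∑ c : K,
          g (Fintype.card K ^ (2 * k + 3) - Fintype.card K ^ (k + 1) * sumSqCount (k + 1) c)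
        + ((Fintype.card K : ℚ) ^ (k + 1) - 1) • (Fintype.card K : ℚ) ^ 2 •
          g (Fintype.card K ^ (2 * k + 3) - Fintype.card K ^ (2 * k + 1)) := by
    intro p
    rw [sum_eq_apply_add_smul (0 : Fin (k + 1) → K) _ ((Fintype.card K : ℚ) ^ 2 •
      g (Fintype.card K ^ (2 * k + 3) - Fintype.card K ^ (2 * k + 1)))]
    · congr 1
      · simp only [formWeight_of_last_ne_zero_of_real hbij h2 hδ hd hκ ht]
        rw [Fintype.sum_prod_type]
        simp only
        rw [Finset.sum_const, Finset.card_univ, ← Nat.cast_smul_eq_nsmul ℚ]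
        congr 1
        -- The constant after completing the square is an affine bijection of the imaginary part of
        -- `z`, so every `c` occurs once.
        exact Equiv.sum_comp ((Equiv.divRight₀ κ hκ).trans
          (Equiv.addRight (∑ i, (p i / (2 * κ)) ^ 2))) (fun c => g (Fintype.card K ^ (2 * k + 3)
            - Fintype.card K ^ (k + 1) * sumSqCount (k + 1) c))
      · simp
    · intro w hw
      rw [Finset.sum_congr rfl fun z _ => by
        rw [formWeight_of_last_ne_zero hbij hδ hd ht z p hw]]
      rw [Finset.sum_const, Finset.card_univ, Fintype.card_prod, ← Nat.cast_smul_eq_nsmul ℚ,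
        Nat.cast_mul, sq]
  rw [Finset.sum_congr rfl fun p _ => hp p, Finset.sum_const, Finset.card_univ,
    ← Nat.cast_smul_eq_nsmul ℚ, smul_add, smul_smul, smul_smul, smul_smul]
  simp only [Fintype.card_pi, Finset.prod_const, Finset.card_univ, Fintype.card_fin, Nat.cast_pow]
  congr 2 <;> ring

theorem sum_linearForm_of_last_eq_zero
    (hbij : Function.Bijective fun p : K × K => (p.1 : F) + ε * p.2) (hd : d ≠ 0)
    {M : Type*} [AddCommGroup M] [Module ℚ M] (g : ℕ → M) :
    ∑ α : Fin (k + 1) → F, ∑ α₀ : F, g (formWeight (coordPoint ε d κ) (linearForm α₀ α 0))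
      = g 0 + ((Fintype.card K : ℚ) ^ 2 - 1) • g (Fintype.card K ^ (2 * k + 3))
        + ((Fintype.card K : ℚ) ^ (2 * k + 4) - (Fintype.card K : ℚ) ^ 2) •
          g (Fintype.card K ^ (2 * k + 3) - Fintype.card K ^ (2 * k + 1)) := by
  rw [sum_eq_apply_add_smul (0 : Fin (k + 1) → F) _ ((Fintype.card K : ℚ) ^ 2 •
      g (Fintype.card K ^ (2 * k + 3) - Fintype.card K ^ (2 * k + 1)))]
  · rw [sum_eq_apply_add_smul (0 : F) _ (g (Fintype.card K ^ (2 * k + 3)))]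
    · rw [formWeight_zero, smul_smul, card_eq_of_bijective hbij]
      simp only [Fintype.card_pi, Finset.prod_const, Finset.card_univ, Fintype.card_fin,
        Nat.cast_pow, card_eq_of_bijective hbij]
      congr 2
      ring
    · intro α₀ h
      rw [formWeight_const h]
      rfl
  · intro α hα
    rw [Finset.sum_congr rfl fun α₀ _ => by rw [formWeight_of_ne_zero hbij hd α₀ hα],
      Finset.sum_const, Finset.card_univ, card_eq_of_bijective hbij, ← Nat.cast_smul_eq_nsmul ℚ,
      Nat.cast_pow]

theorem sum_formWeight
    (hbij : Function.Bijective fun p : K × K => (p.1 : F) + ε * p.2) (h2 : (2 : K) ≠ 0)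
    (hδ : (δ : F) = ε ^ 2) (hd : d ≠ 0) (hκ : κ ≠ 0)
    {M : Type*} [AddCommGroup M] [Module ℚ M] (g : ℕ → M) :
    ∑ α : Fin (k + 1 + 1 + 1) → F, g (formWeight (coordPoint ε d κ) α)
      = g 0 + ((Fintype.card K : ℚ) ^ 2 - 1) • g (Fintype.card K ^ (2 * k + 3))
        + ((Fintype.card K : ℚ) ^ (2 * k + 4) - (Fintype.card K : ℚ) ^ 2
          + ((Fintype.card K : ℚ) ^ (2 * k + 4) - (Fintype.card K : ℚ) ^ (k + 3))
            * ((Fintype.card K : ℚ) ^ 2 - 1)) •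
          g (Fintype.card K ^ (2 * k + 3) - Fintype.card K ^ (2 * k + 1))
        + ((Fintype.card K : ℚ) ^ (k + 2) * ((Fintype.card K : ℚ) ^ 2 - 1)) • ∑ c : K,
          g (Fintype.card K ^ (2 * k + 3) - Fintype.card K ^ (k + 1) * sumSqCount (k + 1) c) := by
  rw [sum_linearForm, sum_eq_apply_add_smul (0 : F) _ _
    fun t ht => sum_linearForm_of_last_ne_zero hbij h2 hδ hd hκ ht g,
    sum_linearForm_of_last_eq_zero hbij hd, card_eq_of_bijective hbij]
  push_cast
  module

end Enumeration

/-! ### Conjugation on `F` and the normal form of the equation -/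

section Conjugation

theorem exists_frobenius_ringHom {F : Type*} [Field F] [Fintype F] {q : ℕ} (hqp : IsPrimePow q)
    (hF : Fintype.card F = q ^ 2) :
    ∃ φ : F →+* F, (∀ x, φ x = x ^ q) ∧ ∀ x, φ (φ x) = x := by
  obtain ⟨p, e, hp, he, rfl⟩ := hqp
  have hp' : p.Prime := hp.nat_prime
  obtain ⟨p₁, hc⟩ := CharP.exists F
  obtain ⟨n₁, hp₁, hn₁⟩ := FiniteField.card F p₁
  have hpp : p₁ = p := by
    have : p₁ ∣ (p ^ e) ^ 2 := by
      rw [← hF, hn₁]; exact dvd_pow_self _ n₁.ne_zero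
    exact (Nat.prime_dvd_prime_iff_eq hp₁ hp').1
      (hp₁.dvd_of_dvd_pow (hp₁.dvd_of_dvd_pow this))
  subst hpp
  have : Fact p₁.Prime := ⟨hp₁⟩
  refine ⟨iterateFrobenius F p₁ e, fun x => iterateFrobenius_def p₁ e x, fun x => ?_⟩
  rw [iterateFrobenius_def, iterateFrobenius_def, ← pow_mul, ← sq, ← hF, FiniteField.pow_card]

variable {F : Type*} [Field F] {φ : F →+* F} {ε : F}

/-- The fixed field of a ring endomorphism. -/
abbrev fixedSubfield (φ : F →+* F) : Subfield F := φ.eqLocusField (RingHom.id F)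

theorem bijective_coordinates (hφ : ∀ x, φ (φ x) = x) (h2 : (2 : F) ≠ 0) (hε : ε ≠ 0)
    (hφε : φ ε = -ε) :
    Function.Bijective fun p : fixedSubfield φ × fixedSubfield φ => (p.1 : F) + ε * p.2 := by
  constructor
  · rintro ⟨⟨s, hs⟩, ⟨u, hu⟩⟩ ⟨⟨s', hs'⟩, ⟨u', hu'⟩⟩ h
    change φ s = s at hs
    change φ u = u at hu
    change φ s' = s' at hs'
    change φ u' = u' at hu'
    dsimp only at h
    have h' := congrArg φ h
    simp only [map_add, map_mul, hφε, hs, hs', hu, hu'] at h'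
    have h1 : s = s' := mul_left_cancel₀ h2 (by linear_combination h + h')
    have h3 : u = u' := mul_left_cancel₀ (mul_ne_zero h2 hε) (by linear_combination h - h')
    subst h1 h3
    rfl
  · intro x
    refine ⟨(⟨(x + φ x) / 2, ?_⟩, ⟨(x - φ x) / (2 * ε), ?_⟩), ?_⟩
    · show φ ((x + φ x) / 2) = (x + φ x) / 2
      rw [map_div₀, map_add, hφ, map_ofNat, add_comm]
    · show φ ((x - φ x) / (2 * ε)) = (x - φ x) / (2 * ε)
      rw [map_div₀, map_sub, hφ, map_mul, hφε, map_ofNat]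
      field_simp
      ring
    · dsimp only
      field_simp
      ring

/-- Hilbert 90 in degree two: `φ y + φ c * y` satisfies the relation for every `y`. The choice `y =
1` is nonzero unless `φ c = -1`, and then `y = ε` gives `-2 * ε`. -/
theorem exists_map_eq_mul (hφ : ∀ x, φ (φ x) = x) (h2 : (2 : F) ≠ 0) (hε : ε ≠ 0)
    (hφε : φ ε = -ε) {c : F} (hc : c * φ c = 1) : ∃ d, d ≠ 0 ∧ φ d = c * d := by
  have hd : ∀ y, φ (φ y + φ c * y) = c * (φ y + φ c * y) := by
    intro y
    rw [map_add, map_mul, hφ, hφ]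
    linear_combination -y * hc
  by_cases h : φ c = -1
  · refine ⟨φ ε + φ c * ε, ?_, hd ε⟩
    rw [hφε, h]
    intro h'
    exact mul_ne_zero h2 hε (by linear_combination -h')
  · refine ⟨φ 1 + φ c * 1, ?_, hd 1⟩
    rw [map_one]
    intro h'
    exact h (by linear_combination h')

/-- With `2 * φ a * φ d = ε * d`, all three terms become multiples of `a * d ^ 2`, and the left side
is `-a * d ^ 2 * ((s + ε * u) - (s - ε * u)) ^ 2`, from which `s` disappears. -/
theorem exists_normalization (hφ : ∀ x, φ (φ x) = x) (h2 : (2 : F) ≠ 0) (hε : ε ≠ 0)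
    (hφε : φ ε = -ε) {a : F} (ha : a ≠ 0) (hab : 4 * (a * φ a) + ε ^ 2 = 0) :
    ∃ (d : F) (κ : fixedSubfield φ), d ≠ 0 ∧ κ ≠ 0 ∧
      ∀ s u : fixedSubfield φ, φ a * φ (d * (s + ε * u)) ^ 2 - a * (d * (s + ε * u)) ^ 2
        - ε * (d * (s + ε * u) * φ (d * (s + ε * u))) = 2 * ε * (κ * (u : F) ^ 2) := by
  have ha' : φ a ≠ 0 := (map_ne_zero φ).2 ha
  obtain ⟨d, hd, hφd⟩ := exists_map_eq_mul (c := ε / (2 * φ a)) hφ h2 hε hφε (by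
    rw [map_div₀, map_mul, hφε, hφ, map_ofNat]
    field_simp
    linear_combination -hab)
  have hd' : φ d ≠ 0 := (map_ne_zero φ).2 hd
  have hφd2 : 2 * φ a * φ d = ε * d := by
    rw [hφd]; field_simp
  have had : φ a * φ d ^ 2 = -a * d ^ 2 := by
    refine mul_left_cancel₀ (mul_ne_zero (mul_ne_zero h2 h2) ha') ?_
    linear_combination (2 * φ a * φ d + ε * d) * hφd2 + d ^ 2 * hab
  -- By `had` the square above equals `4 * φ a * φ d ^ 2 * ε ^ 2 * u ^ 2`; removing `2 * ε * u ^ 2`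
  -- gives `κ`.
  refine ⟨d, ⟨2 * φ a * φ d ^ 2 * ε, ?_⟩, hd, ?_, ?_⟩
  · change φ _ = _
    simp only [map_mul, map_pow, hφ, hφε, map_ofNat]
    linear_combination -2 * ε * had
  · rw [Ne, Subtype.ext_iff]
    simp [h2, ha', hd', hε]
  · rintro ⟨s, hs⟩ ⟨u, hu⟩
    change φ s = s at hs
    change φ u = u at hu
    simp only [map_mul, map_add, hφε, hs, hu]
    linear_combination -(s + ε * u) ^ 2 * had + (s - ε * u) * (s + ε * u) * φ d * hφd2

theorem sum_Ioo_zero_last {M : Type*} [AddCommMonoid M] {m : ℕ} (f : Fin (m + 1 + 1) → M) :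
    ∑ i ∈ Finset.Ioo 0 (Fin.last (m + 1)), f i = ∑ i : Fin m, f i.castSucc.succ := by
  symm
  refine Finset.sum_bij (fun i _ => i.castSucc.succ) ?_ ?_ ?_ ?_
  · intro i _
    rw [Finset.mem_Ioo]
    exact ⟨Fin.succ_pos _, by rw [← Fin.succ_last, Fin.succ_lt_succ_iff]; exact i.castSucc_lt_last⟩
  · intro i _ j _ h
    exact Fin.castSucc_injective _ (Fin.succ_injective _ h)
  · intro i hi
    rw [Finset.mem_Ioo] at hi
    obtain ⟨j, rfl⟩ := Fin.exists_succ_eq.2 hi.1.ne'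
    have hj : j ≠ Fin.last m := by
      rintro rfl
      exact hi.2.ne (Fin.succ_last _)
    obtain ⟨l, rfl⟩ := Fin.exists_castSucc_eq.2 hj
    exact ⟨l, Finset.mem_univ _, rfl⟩
  · intro i _
    rfl

theorem coordPoint_injective {K : Subfield F} {m : ℕ} {d : F} (hd : d ≠ 0) (κ : K)
    (hbij : Function.Bijective fun p : K × K => (p.1 : F) + ε * p.2) :
    Function.Injective (coordPoint (m := m) ε d κ) := by
  rintro ⟨s, u, y⟩ ⟨s', u', y'⟩ h
  have hi : ∀ i : Fin m, (s i, u i) = (s' i, u' i) := by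
    intro i
    have := congrFun h i.castSucc.succ
    simp only [coordPoint, Fin.cons_succ, Fin.snoc_castSucc] at this
    exact hbij.1 (mul_left_cancel₀ hd this)
  have hs : s = s' := funext fun i => (Prod.ext_iff.1 (hi i)).1
  have hu : u = u' := funext fun i => (Prod.ext_iff.1 (hi i)).2
  subst hs hu
  have := congrFun h (Fin.last m).succ
  simp only [coordPoint, Fin.cons_succ, Fin.snoc_last] at this
  rw [Subtype.ext (add_right_cancel this)]

/-- For `x_r = y + ε * z` one has `x_r ^ q - x_r = -2 * ε * z`, so the equation fixes `z` and leaves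
`y` free. -/
theorem exists_affineSet_eq_range {q m : ℕ} (hφq : ∀ x, φ x = x ^ q) (hφ : ∀ x, φ (φ x) = x)
    (h2 : (2 : F) ≠ 0) {a b : F} (ha : a ≠ 0) (hb : b ^ q ≠ b)
    (hab : 4 * a ^ (q + 1) + (b ^ q - b) ^ 2 = 0) :
    ∃ (ε d : F) (κ δ : fixedSubfield φ), d ≠ 0 ∧ κ ≠ 0 ∧ (δ : F) = ε ^ 2 ∧
      (Function.Bijective fun p : fixedSubfield φ × fixedSubfield φ => (p.1 : F) + ε * p.2) ∧
      affineSet q (m + 1) a b = Set.range (coordPoint (m := m) ε d κ) := by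
  obtain ⟨ε, hεb⟩ : ∃ ε, ε = b ^ q - b := ⟨_, rfl⟩
  have hε : ε ≠ 0 := hεb ▸ sub_ne_zero.2 hb
  have hφε : φ ε = -ε := by
    rw [hεb, ← hφq, map_sub, hφ]; ring
  have hbij := bijective_coordinates hφ h2 hε hφε
  obtain ⟨d, κ, hd, hκ, hform⟩ := exists_normalization hφ h2 hε hφε ha (by
    rw [hφq, ← pow_succ', hεb]; exact hab)
  have key : ∀ (s u : Fin m → fixedSubfield φ) (y z : fixedSubfield φ),
      (((y : F) + ε * z) ^ q - (y + ε * z)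
          + a ^ q * (∑ i, (d * ((s i : F) + ε * u i)) ^ (2 * q))
          - a * (∑ i, (d * ((s i : F) + ε * u i)) ^ 2)
        = ε * ∑ i, (d * ((s i : F) + ε * u i)) ^ (q + 1))
      ↔ (z : F) = κ * ∑ i, (u i : F) ^ 2 := by
    intro s u y z
    have hy : φ (y : F) = y := y.2
    have hz : φ (z : F) = z := z.2
    have hsum : a ^ q * (∑ i, (d * ((s i : F) + ε * u i)) ^ (2 * q))
          - a * (∑ i, (d * ((s i : F) + ε * u i)) ^ 2)
          - ε * ∑ i, (d * ((s i : F) + ε * u i)) ^ (q + 1)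
        = 2 * ε * (κ * ∑ i, (u i : F) ^ 2) := by
      simp only [Finset.mul_sum, ← Finset.sum_sub_distrib]
      refine Finset.sum_congr rfl fun i _ => ?_
      rw [← hform (s i) (u i), hφq, hφq]
      ring
    rw [← hφq]
    simp only [map_add, map_mul, hφε, hy, hz]
    constructor
    · intro h
      refine mul_left_cancel₀ (mul_ne_zero h2 hε) ?_
      linear_combination hsum - h
    · intro h
      linear_combination hsum - 2 * ε * h
  refine ⟨ε, d, κ, ⟨ε ^ 2, ?_⟩, hd, hκ, rfl, hbij, ?_⟩
  · change φ _ = _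
    rw [map_pow, hφε, neg_sq]
    rfl
  · ext x
    simp only [affineSet, Set.mem_ofPred_eq, sum_Ioo_zero_last, ← hεb, Set.mem_range]
    constructor
    · rintro ⟨h0, hx⟩
      choose f hf using fun i : Fin m => hbij.2 (x i.castSucc.succ / d)
      obtain ⟨⟨y, z⟩, hyz⟩ := hbij.2 (x (Fin.last (m + 1)))
      dsimp only at hf hyz
      have hx' : ∀ i, x (Fin.succ (Fin.castSucc i)) = d * (((f i).1 : F) + ε * (f i).2) := by
        intro i; rw [hf, mul_div_cancel₀ _ hd]
      simp only [hx', ← hyz] at hx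
      have hz := (key (fun i => (f i).1) (fun i => (f i).2) y z).1 hx
      refine ⟨(fun i => (f i).1, fun i => (f i).2, y), funext fun i => ?_⟩
      refine Fin.cases ?_ (fun i => ?_) i
      · simp [coordPoint, h0]
      · refine Fin.lastCases ?_ (fun i => ?_) i
        · simp only [coordPoint, Fin.cons_succ, Fin.snoc_last]
          rw [← hz, Fin.succ_last, ← hyz]
        · simp only [coordPoint, Fin.cons_succ, Fin.snoc_castSucc]
          rw [hx']
    · rintro ⟨⟨s, u, y⟩, rfl⟩
      refine ⟨by simp [coordPoint], ?_⟩
      rw [← Fin.succ_last]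
      simp only [coordPoint, Fin.cons_succ, Fin.snoc_last, Fin.snoc_castSucc]
      have := (key s u y (κ * ∑ i, u i ^ 2)).2 (by push_cast; rfl)
      push_cast at this
      exact this

end Conjugation

/-! ### Evaluating the remaining sum over `c` -/

section Evaluation

variable {K : Type*} [Field K] [Fintype K] [DecidableEq K]
  {M : Type*} [AddCommGroup M] [Module ℚ M]

/-- Ensures that the natural-number subtractions in the weights do not truncate. -/
theorem add_pow_lt_pow {q i j n : ℕ} (hq : 3 ≤ q) (hi : i < n) (hj : j < n) :
    q ^ i + q ^ j < q ^ n := by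
  obtain ⟨n, rfl⟩ : ∃ n', n = n' + 1 := ⟨n - 1, by omega⟩
  have h1 : q ^ i ≤ q ^ n := Nat.pow_le_pow_right (by omega) (by omega)
  have h2 : q ^ j ≤ q ^ n := Nat.pow_le_pow_right (by omega) (by omega)
  have h3 : 0 < q ^ n := by positivity
  calc q ^ i + q ^ j < 3 * q ^ n := by omega
    _ ≤ q * q ^ n := Nat.mul_le_mul_right _ hq
    _ = q ^ (n + 1) := (pow_succ' _ _).symm

theorem sum_sumSqCount_even_of_pos (hK : ringChar K ≠ 2) {q l : ℕ} (hq : 3 ≤ q)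
    (hc : Fintype.card K = q) (hχ : quadraticChar K (-1) ^ (l + 1) = 1) (g : ℕ → M) :
    ∑ c : K, g (q ^ (4 * l + 5) - q ^ (2 * l + 2) * sumSqCount (2 * l + 2) c)
      = g (q ^ (4 * l + 5) - q ^ (4 * l + 3) - q ^ (3 * l + 3) + q ^ (3 * l + 2))
        + ((q : ℚ) - 1) • g (q ^ (4 * l + 5) - q ^ (4 * l + 3) + q ^ (3 * l + 2)) := by
  -- For an even number of squares only `c = 0` is exceptional. The negative term is moved to the
  -- left so that the identity descends to `ℕ`.
  have hN : ∀ c : K, ((q ^ (2 * l + 2) * sumSqCount (2 * l + 2) c + q ^ (3 * l + 2) : ℕ) : ℤ)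
      = q ^ (4 * l + 3) + if c = 0 then (q : ℤ) ^ (3 * l + 3) else 0 := by
    intro c
    have h := card_mul_sumSqCount_even hK (l + 1) c
    rw [hc, mul_pow, hχ, show 2 * (l + 1) = 2 * l + 2 by ring] at h
    push_cast
    split_ifs at h ⊢ <;> linear_combination (q : ℤ) ^ (2 * l + 1) * h
  have hlt := add_pow_lt_pow (i := 4 * l + 3) (j := 3 * l + 3) (n := 4 * l + 5) hq
    (by omega) (by omega)
  have hle : q ^ (3 * l + 2) ≤ q ^ (3 * l + 3) := Nat.pow_le_pow_right (by omega) (by omega)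
  have hle' : q ^ (3 * l + 2) ≤ q ^ (4 * l + 3) := Nat.pow_le_pow_right (by omega) (by omega)
  rw [sum_eq_apply_add_smul (0 : K) _
    (g (q ^ (4 * l + 5) - q ^ (4 * l + 3) + q ^ (3 * l + 2))), hc]
  · congr 2
    have h := hN 0
    rw [if_pos rfl] at h
    norm_cast at h
    omega
  · intro c hc0
    congr 1
    have h := hN c
    rw [if_neg hc0, add_zero] at h
    norm_cast at h
    omega

theorem sum_sumSqCount_even_of_neg (hK : ringChar K ≠ 2) {q l : ℕ} (hq : 3 ≤ q)
    (hc : Fintype.card K = q) (hχ : quadraticChar K (-1) ^ (l + 1) = -1) (g : ℕ → M) :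
    ∑ c : K, g (q ^ (4 * l + 5) - q ^ (2 * l + 2) * sumSqCount (2 * l + 2) c)
      = g (q ^ (4 * l + 5) - q ^ (4 * l + 3) + q ^ (3 * l + 3) - q ^ (3 * l + 2))
        + ((q : ℚ) - 1) • g (q ^ (4 * l + 5) - q ^ (4 * l + 3) - q ^ (3 * l + 2)) := by
  have hN : ∀ c : K, ((q ^ (2 * l + 2) * sumSqCount (2 * l + 2) c : ℕ) : ℤ)
      + (if c = 0 then (q : ℤ) ^ (3 * l + 3) else 0)
      = q ^ (4 * l + 3) + q ^ (3 * l + 2) := by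
    intro c
    have h := card_mul_sumSqCount_even hK (l + 1) c
    rw [hc, mul_pow, hχ, show 2 * (l + 1) = 2 * l + 2 by ring] at h
    push_cast
    split_ifs at h ⊢ <;> linear_combination (q : ℤ) ^ (2 * l + 1) * h
  have hlt := add_pow_lt_pow (i := 4 * l + 3) (j := 3 * l + 3) (n := 4 * l + 5) hq
    (by omega) (by omega)
  have hle : q ^ (3 * l + 2) ≤ q ^ (3 * l + 3) := Nat.pow_le_pow_right (by omega) (by omega)
  rw [sum_eq_apply_add_smul (0 : K) _
    (g (q ^ (4 * l + 5) - q ^ (4 * l + 3) - q ^ (3 * l + 2))), hc]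
  · congr 2
    have h := hN 0
    rw [if_pos rfl] at h
    norm_cast at h
    omega
  · intro c hc0
    congr 1
    have h := hN c
    rw [if_neg hc0, add_zero] at h
    norm_cast at h
    omega

/-- Multiplying `c` by a nonresidue flips the sign of the character, so the sum may be averaged with
its reflection; this also makes `s` irrelevant. -/
theorem sum_apply_quadraticChar (hK : ringChar K ≠ 2) {s : ℤ} (hs : s = 1 ∨ s = -1)
    (g : ℤ → M) :
    ∑ c : K, g (s * quadraticChar K c)
      = g 0 + ((Fintype.card K : ℚ) - 1) • (1 / 2 : ℚ) • (g 1 + g (-1)) := by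
  obtain ⟨n, hn⟩ := quadraticChar_exists_neg_one' hK
  have h1 : ∑ c : K, g (s * quadraticChar K c) = ∑ c : K, g (-(s * quadraticChar K c)) := by
    rw [← Equiv.sum_comp (Equiv.mulLeft₀ (n : K) n.ne_zero)]
    refine Finset.sum_congr rfl fun c _ => ?_
    rw [Equiv.mulLeft₀_apply, map_mul, hn]
    congr 1
    ring
  have h2 : (2 : ℚ) • ∑ c : K, g (s * quadraticChar K c)
      = ∑ c : K, (g (s * quadraticChar K c) + g (-(s * quadraticChar K c))) := by
    rw [Finset.sum_add_distrib, ← h1, two_smul]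
  refine smul_right_injective M (two_ne_zero : (2 : ℚ) ≠ 0) ?_
  dsimp only
  rw [h2, sum_eq_apply_add_smul (0 : K) _ (g 1 + g (-1))]
  · rw [quadraticChar_zero, mul_zero, neg_zero]
    module
  · intro c hc
    rcases hs with rfl | rfl <;> rcases quadraticChar_dichotomy hc with h | h <;> rw [h] <;>
      simp only [one_mul, mul_one, neg_neg, neg_mul]
    · exact add_comm _ _
    · exact add_comm _ _

/-- The sign `χ (-1) ^ l` only swaps two equally frequent values, hence no congruence condition on
`q` for even `r`. -/
theorem sum_sumSqCount_odd (hK : ringChar K ≠ 2) {q l : ℕ} (hq : 3 ≤ q)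
    (hc : Fintype.card K = q) (g : ℕ → M) :
    ∑ c : K, g (q ^ (4 * l + 3) - q ^ (2 * l + 1) * sumSqCount (2 * l + 1) c)
      = g (q ^ (4 * l + 3) - q ^ (4 * l + 1))
        + ((q : ℚ) - 1) • (1 / 2 : ℚ) • (g (q ^ (4 * l + 3) - q ^ (4 * l + 1) - q ^ (3 * l + 1))
          + g (q ^ (4 * l + 3) - q ^ (4 * l + 1) + q ^ (3 * l + 1))) := by
  have hs : quadraticChar K (-1) ^ l = 1 ∨ quadraticChar K (-1) ^ l = -1 := by
    rcases quadraticChar_dichotomy (F := K) (neg_ne_zero.2 one_ne_zero) with h | h <;> rw [h]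
    · simp
    · exact neg_one_pow_eq_or ℤ l
  have hlt := add_pow_lt_pow (i := 4 * l + 1) (j := 3 * l + 1) (n := 4 * l + 3) hq
    (by omega) (by omega)
  have hle' : q ^ (3 * l + 1) ≤ q ^ (4 * l + 1) := Nat.pow_le_pow_right (by omega) (by omega)
  -- Passing through `toNat` makes the weight a function of an integer sign, as the averaging lemma
  -- requires.
  have hN : ∀ c : K, g (q ^ (4 * l + 3) - q ^ (2 * l + 1) * sumSqCount (2 * l + 1) c)
      = g ((q : ℤ) ^ (4 * l + 3) - q ^ (4 * l + 1)
        - q ^ (3 * l + 1) * (quadraticChar K (-1) ^ l * quadraticChar K c)).toNat := by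
    intro c
    have h : ((q ^ (2 * l + 1) * sumSqCount (2 * l + 1) c : ℕ) : ℤ) = (q : ℤ) ^ (4 * l + 1)
        + q ^ (3 * l + 1) * (quadraticChar K (-1) ^ l * quadraticChar K c) := by
      push_cast
      rw [sumSqCount_odd hK, hc, mul_pow]
      ring
    rw [sub_sub, ← h]
    congr 1
    simp only [← Nat.cast_pow]
    omega
  rw [Finset.sum_congr rfl fun c _ => hN c, sum_apply_quadraticChar hK hs
    (fun x => g ((q : ℤ) ^ (4 * l + 3) - q ^ (4 * l + 1) - q ^ (3 * l + 1) * x).toNat), hc]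
  congr 3
  · simp only [← Nat.cast_pow, mul_zero]
    omega
  · congr 2
    · simp only [← Nat.cast_pow, mul_one]
      omega
    · simp only [← Nat.cast_pow, mul_neg, mul_one]
      omega

end Evaluation

/-! ### Assembly: the weight enumerator before splitting by parity of `r` -/

theorem exists_weightEnumerator_eq {F : Type*} [Field F] [Fintype F] [DecidableEq F]
    {q k : ℕ} (hqp : IsPrimePow q) (hqo : Odd q) (hF : Fintype.card F = q ^ 2)
    {a b : F} (ha : a ≠ 0) (hb : b ^ q ≠ b) (hab : 4 * a ^ (q + 1) + (b ^ q - b) ^ 2 = 0) :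
    ∃ (K : Subfield F) (_ : Fintype K), Fintype.card K = q ∧ ringChar K ≠ 2 ∧
      (∃ G : Matrix (Fin (k + 2 + 1)) (Fin (q ^ (2 * k + 3))) F,
        IsPointMatrix (pointSet q (k + 2) a b) G) ∧
      ∀ (n : ℕ) (G : Matrix (Fin (k + 2 + 1)) (Fin n) F),
        IsPointMatrix (pointSet q (k + 2) a b) G →
        n = q ^ (2 * k + 3) ∧ Module.finrank F (rowCode G) = k + 2 + 1 ∧
        IsProjectiveCode (rowCode G) ∧
        weightEnumerator (rowCode G) = Polynomial.monomial 0 1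
          + ((q : ℚ) ^ 2 - 1) • Polynomial.monomial (q ^ (2 * k + 3)) 1
          + ((q : ℚ) ^ (2 * k + 4) - (q : ℚ) ^ 2
            + ((q : ℚ) ^ (2 * k + 4) - (q : ℚ) ^ (k + 3)) * ((q : ℚ) ^ 2 - 1)) •
              Polynomial.monomial (q ^ (2 * k + 3) - q ^ (2 * k + 1)) 1
          + ((q : ℚ) ^ (k + 2) * ((q : ℚ) ^ 2 - 1)) • ∑ c : K,
              Polynomial.monomial (q ^ (2 * k + 3) - q ^ (k + 1) * sumSqCount (k + 1) c) 1 := by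
  obtain ⟨φ, hφq, hφ⟩ := exists_frobenius_ringHom hqp hF
  have hchar : ringChar F ≠ 2 := by
    rw [Ne, FiniteField.even_card_iff_char_two, hF]
    have : q ^ 2 % 2 = 1 := Nat.odd_iff.1 hqo.pow
    omega
  have h2 : (2 : F) ≠ 0 := Ring.two_ne_zero hchar
  obtain ⟨ε, d, κ, δ, hd, hκ, hδ, hbij, hB⟩ :=
    exists_affineSet_eq_range (m := k + 1) hφq hφ h2 ha hb hab
  let _ : Fintype (fixedSubfield φ) := Fintype.ofFinite _
  have hcard : Fintype.card (fixedSubfield φ) = q := by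
    have := card_eq_of_bijective hbij
    rw [hF] at this
    exact (Nat.pow_left_injective two_ne_zero this).symm
  have hK2 : (2 : fixedSubfield φ) ≠ 0 := fun h => h2 (by
    have := congrArg (fixedSubfield φ).subtype h
    rwa [map_ofNat, map_zero] at this)
  have hcharK : ringChar (fixedSubfield φ) ≠ 2 := by
    rw [Ne, FiniteField.even_card_iff_char_two, hcard]
    have := Nat.odd_iff.1 hqo
    omega
  have hpt := coordPoint_injective (m := k + 1) hd κ hbij
  have h1 : ∀ τ, coordPoint (m := k + 1) ε d κ τ 0 = 1 := fun τ => by simp [coordPoint]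
  have hT := card_coordinates (K := fixedSubfield φ) (m := k + 1)
  rw [hcard] at hT
  refine ⟨fixedSubfield φ, inferInstance, hcard, hcharK, ?_, fun n G hG => ?_⟩
  · unfold pointSet
    rw [hB]
    exact exists_isPointMatrix hpt h1 hT
  · have hproj := isProjectiveCode_rowCode hG
    unfold pointSet at hG
    rw [hB] at hG
    obtain ⟨e, s, hs, hGs⟩ := hG.exists_equiv hpt h1
    have hspan := eq_zero_of_forall_coordPoint (m := k + 1) (ε := ε) hd κ
    refine ⟨?_, finrank_rowCode (encoder_injective e s hs hGs hspan), hproj, ?_⟩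
    · rw [← Fintype.card_fin n, Fintype.card_congr e, hT]
      rfl
    · rw [weightEnumerator_eq_sum e s hs hGs hspan]
      have := sum_formWeight (k := k) hbij hK2 hδ hd hκ
        (fun w => Polynomial.monomial w (1 : ℚ))
      rw [hcard] at this
      exact this

theorem quadraticChar_neg_one_pow_eq_one {K : Type*} [Field K] [Fintype K] [DecidableEq K]
    (hK : ringChar K ≠ 2) {l : ℕ} (h : Even l ∨ Fintype.card K % 4 = 1) :
    quadraticChar K (-1) ^ l = 1 := by
  rcases h with h | h
  · rcases quadraticChar_dichotomy (F := K) (neg_ne_zero.2 one_ne_zero) with h' | h' <;> rw [h']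
    · exact one_pow l
    · exact h.neg_one_pow
  · rw [quadraticChar_neg_one hK, ZMod.χ₄_nat_one_mod_four h, one_pow]

end FourWeightCode

/-! ### The theorem, by the parity of `r` -/

theorem theorem4p1 {F : Type*} [Field F] [Fintype F] [DecidableEq F]
    (q r : ℕ) (hqp : IsPrimePow q) (hqo : Odd q) (hF : Fintype.card F = q ^ 2) (hr : 2 ≤ r)
    (a b : F) (ha : a ≠ 0) (hb : b ^ q ≠ b)
    (hab : 4 * a ^ (q + 1) + (b ^ q - b) ^ 2 = 0) :
    (∃ G : Matrix (Fin (r + 1)) (Fin (q ^ (2 * r - 1))) F,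
      FourWeightCode.IsPointMatrix (FourWeightCode.pointSet q r a b) G) ∧
    ∀ (n : ℕ) (G : Matrix (Fin (r + 1)) (Fin n) F),
      FourWeightCode.IsPointMatrix (FourWeightCode.pointSet q r a b) G →
      n = q ^ (2 * r - 1) ∧
      Module.finrank F (FourWeightCode.rowCode G) = r + 1 ∧
      FourWeightCode.IsProjectiveCode (FourWeightCode.rowCode G) ∧
      ((r % 4 = 1 ∨ (Odd r ∧ q % 4 = 1)) →
        FourWeightCode.weightEnumerator (FourWeightCode.rowCode G) =
          Polynomial.monomial 0 (1 : ℚ)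
          + Polynomial.monomial (q ^ (2 * r - 1)) ((q : ℚ) ^ 2 - 1)
          + Polynomial.monomial
              (q ^ (2 * r - 1) - q ^ (2 * r - 3) - q ^ (3 * (r - 1) / 2) + q ^ ((3 * r - 5) / 2))
              ((q : ℚ) ^ (r + 2) - (q : ℚ) ^ r)
          + Polynomial.monomial
              (q ^ (2 * r - 1) - q ^ (2 * r - 3))
              ((q : ℚ) ^ (2 * r) - (q : ℚ) ^ 2
                + ((q : ℚ) ^ (2 * r) - (q : ℚ) ^ (r + 1)) * ((q : ℚ) ^ 2 - 1))
          + Polynomial.monomial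
              (q ^ (2 * r - 1) - q ^ (2 * r - 3) + q ^ ((3 * r - 5) / 2))
              (((q : ℚ) ^ (r + 1) - (q : ℚ) ^ r) * ((q : ℚ) ^ 2 - 1))) ∧
      ((r % 4 = 3 ∧ q % 4 = 3) →
        FourWeightCode.weightEnumerator (FourWeightCode.rowCode G) =
          Polynomial.monomial 0 (1 : ℚ)
          + Polynomial.monomial (q ^ (2 * r - 1)) ((q : ℚ) ^ 2 - 1)
          + Polynomial.monomial
              (q ^ (2 * r - 1) - q ^ (2 * r - 3) - q ^ ((3 * r - 5) / 2))
              (((q : ℚ) ^ (r + 1) - (q : ℚ) ^ r) * ((q : ℚ) ^ 2 - 1))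
          + Polynomial.monomial
              (q ^ (2 * r - 1) - q ^ (2 * r - 3))
              ((q : ℚ) ^ (2 * r) - (q : ℚ) ^ 2
                + ((q : ℚ) ^ (2 * r) - (q : ℚ) ^ (r + 1)) * ((q : ℚ) ^ 2 - 1))
          + Polynomial.monomial
              (q ^ (2 * r - 1) - q ^ (2 * r - 3) + q ^ (3 * (r - 1) / 2) - q ^ ((3 * r - 5) / 2))
              ((q : ℚ) ^ (r + 2) - (q : ℚ) ^ r)) ∧
      (Even r →
        FourWeightCode.weightEnumerator (FourWeightCode.rowCode G) =
          Polynomial.monomial 0 (1 : ℚ)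
          + Polynomial.monomial (q ^ (2 * r - 1)) ((q : ℚ) ^ 2 - 1)
          + Polynomial.monomial
              (q ^ (2 * r - 1) - q ^ (2 * r - 3) + q ^ ((3 * r - 4) / 2))
              (1 / 2 * ((q : ℚ) ^ (r + 1) - (q : ℚ) ^ r) * ((q : ℚ) ^ 2 - 1))
          + Polynomial.monomial
              (q ^ (2 * r - 1) - q ^ (2 * r - 3) - q ^ ((3 * r - 4) / 2))
              (1 / 2 * ((q : ℚ) ^ (r + 1) - (q : ℚ) ^ r) * ((q : ℚ) ^ 2 - 1))
          + Polynomial.monomial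
              (q ^ (2 * r - 1) - q ^ (2 * r - 3))
              ((q : ℚ) ^ (2 * r) + (q : ℚ) ^ (r + 2) - (q : ℚ) ^ r - (q : ℚ) ^ 2
                + ((q : ℚ) ^ (2 * r) - (q : ℚ) ^ (r + 1)) * ((q : ℚ) ^ 2 - 1))) ∧
      (3 ≤ r →
        FourWeightCode.weightCount (FourWeightCode.rowCode G) (q ^ (2 * r - 1)) = q ^ 2 - 1 ∧
        {i : ℕ | i ≠ 0 ∧
          FourWeightCode.weightCount (FourWeightCode.rowCode G) i ≠ 0}.ncard = 4) := by
  have hq3 : 3 ≤ q := by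
    have := hqp.two_le
    rcases hqo with ⟨j, rfl⟩
    omega
  have hq1 : (3 : ℚ) ≤ q := by exact_mod_cast hq3
  have hlt : ∀ i j, i < j → (q : ℚ) ^ i < (q : ℚ) ^ j := fun i j hij =>
    pow_lt_pow_right₀ (by linarith) hij
  have hA₀ : (q : ℚ) ^ 2 - 1 ≠ 0 := by nlinarith
  have hpos : (0 : ℚ) < (q : ℚ) ^ 2 - 1 := by nlinarith
  rcases Nat.even_or_odd' r with ⟨l, rfl | rfl⟩
  · obtain ⟨l, rfl⟩ : ∃ l', l = l' + 1 := ⟨l - 1, by omega⟩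
    obtain ⟨K, _, hK, hchar, hex, hall⟩ :=
      FourWeightCode.exists_weightEnumerator_eq (k := 2 * l) hqp hqo hF ha hb hab
    rw [show 2 * (2 * (l + 1)) - 1 = 4 * l + 3 by omega,
      show 2 * (2 * (l + 1)) - 3 = 4 * l + 1 by omega,
      show (3 * (2 * (l + 1)) - 4) / 2 = 3 * l + 1 by omega]
    rw [show 2 * (2 * l) + 3 = 4 * l + 3 by ring, show 2 * (2 * l) + 1 = 4 * l + 1 by ring,
      show 2 * (2 * l) + 4 = 2 * (2 * (l + 1)) by ring] at hall
    rw [show 2 * (2 * l) + 3 = 4 * l + 3 by ring] at hex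
    refine ⟨hex, fun n G hG => ?_⟩
    obtain ⟨hn, hrank, hproj, hw⟩ := hall n G hG
    rw [FourWeightCode.sum_sumSqCount_odd hchar hq3 hK
      (fun w => Polynomial.monomial w (1 : ℚ))] at hw
    have hE : FourWeightCode.weightEnumerator (FourWeightCode.rowCode G) =
          Polynomial.monomial 0 (1 : ℚ)
          + Polynomial.monomial (q ^ (4 * l + 3)) ((q : ℚ) ^ 2 - 1)
          + Polynomial.monomial (q ^ (4 * l + 3) - q ^ (4 * l + 1) + q ^ (3 * l + 1))
              (1 / 2 * ((q : ℚ) ^ (2 * (l + 1) + 1) - (q : ℚ) ^ (2 * (l + 1)))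
                * ((q : ℚ) ^ 2 - 1))
          + Polynomial.monomial (q ^ (4 * l + 3) - q ^ (4 * l + 1) - q ^ (3 * l + 1))
              (1 / 2 * ((q : ℚ) ^ (2 * (l + 1) + 1) - (q : ℚ) ^ (2 * (l + 1)))
                * ((q : ℚ) ^ 2 - 1))
          + Polynomial.monomial (q ^ (4 * l + 3) - q ^ (4 * l + 1))
              ((q : ℚ) ^ (2 * (2 * (l + 1))) + (q : ℚ) ^ (2 * (l + 1) + 2)
                - (q : ℚ) ^ (2 * (l + 1)) - (q : ℚ) ^ 2
                + ((q : ℚ) ^ (2 * (2 * (l + 1))) - (q : ℚ) ^ (2 * (l + 1) + 1))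
                  * ((q : ℚ) ^ 2 - 1)) := by
      have hm : ∀ (w : ℕ) (A : ℚ), Polynomial.monomial w A = A • Polynomial.monomial w 1 := by
        intro w A
        rw [Polynomial.smul_monomial, smul_eq_mul, mul_one]
      rw [hw, hm _ ((q : ℚ) ^ 2 - 1), hm _ (1 / 2 * _ * _), hm _ (1 / 2 * _ * _),
        hm _ (_ + _ * ((q : ℚ) ^ 2 - 1))]
      module
    refine ⟨hn, hrank, hproj, fun h => ?_, fun h => ?_, fun _ => hE, fun hr3 => ?_⟩
    · exfalso
      rcases h with h | ⟨h, -⟩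
      · omega
      · exact (Nat.not_odd_iff_even.2 (even_two_mul _)) h
    · omega
    · have h1 := FourWeightCode.add_pow_lt_pow (i := 4 * l + 1) (j := 3 * l + 1) (n := 4 * l + 3)
        hq3 (by omega) (by omega)
      -- Strictness needs `l > 0`: for `r = 2` the largest of the three other weights coincides with
      -- the length.
      have h2 : q ^ (3 * l + 1) < q ^ (4 * l + 1) :=
        Nat.pow_lt_pow_right (by omega) (by omega)
      have h3 : 0 < q ^ (3 * l + 1) := by positivity
      have hA := mul_pos (mul_pos (one_half_pos (α := ℚ))
        (sub_pos.2 (hlt (2 * (l + 1)) (2 * (l + 1) + 1) (by omega)))) hpos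
      have hB := mul_pos (sub_pos.2 (hlt (2 * (l + 1) + 1) (2 * (2 * (l + 1))) (by omega))) hpos
      have hC := hlt 2 (2 * (2 * (l + 1))) (by omega)
      have hD := hlt (2 * (l + 1)) (2 * (l + 1) + 2) (by omega)
      obtain ⟨hc, hw4⟩ := FourWeightCode.four_weights_of_weightEnumerator
        (w₀ := q ^ (4 * l + 3)) (w₁ := q ^ (4 * l + 3) - q ^ (4 * l + 1) - q ^ (3 * l + 1))
        (w₂ := q ^ (4 * l + 3) - q ^ (4 * l + 1))
        (w₃ := q ^ (4 * l + 3) - q ^ (4 * l + 1) + q ^ (3 * l + 1))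
        (hw := hE.trans (by abel)) hA₀ hA.ne' (by linarith) hA.ne' (by omega) (by omega)
        (by omega) (by omega)
      refine ⟨?_, hw4⟩
      rw [← Nat.cast_inj (R := ℚ), hc, Nat.cast_sub (Nat.one_le_pow _ _ (by omega))]
      push_cast
      ring
  · obtain ⟨l, rfl⟩ : ∃ l', l = l' + 1 := ⟨l - 1, by omega⟩
    obtain ⟨K, _, hK, hchar, hex, hall⟩ :=
      FourWeightCode.exists_weightEnumerator_eq (k := 2 * l + 1) hqp hqo hF ha hb hab
    rw [show 2 * (2 * (l + 1) + 1) - 1 = 4 * l + 5 by omega,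
      show 2 * (2 * (l + 1) + 1) - 3 = 4 * l + 3 by omega,
      show 3 * (2 * (l + 1) + 1 - 1) / 2 = 3 * l + 3 by omega,
      show (3 * (2 * (l + 1) + 1) - 5) / 2 = 3 * l + 2 by omega]
    rw [show 2 * (2 * l + 1) + 3 = 4 * l + 5 by ring,
      show 2 * (2 * l + 1) + 1 = 4 * l + 3 by ring,
      show 2 * (2 * l + 1) + 4 = 2 * (2 * (l + 1) + 1) by ring] at hall
    rw [show 2 * (2 * l + 1) + 3 = 4 * l + 5 by ring] at hex
    refine ⟨hex, fun n G hG => ?_⟩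
    obtain ⟨hn, hrank, hproj, hw⟩ := hall n G hG
    have h1 := FourWeightCode.add_pow_lt_pow (i := 4 * l + 3) (j := 3 * l + 3) (n := 4 * l + 5)
      hq3 (by omega) (by omega)
    have h2 : q ^ (3 * l + 3) ≤ q ^ (4 * l + 3) := Nat.pow_le_pow_right (by omega) (by omega)
    have h3 : q ^ (3 * l + 2) < q ^ (3 * l + 3) := Nat.pow_lt_pow_right (by omega) (by omega)
    have h4 : 0 < q ^ (3 * l + 2) := by positivity
    have hA := sub_pos.2 (hlt (2 * (l + 1) + 1) (2 * (l + 1) + 1 + 2) (by omega))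
    have hC := mul_pos
      (sub_pos.2 (hlt (2 * (l + 1) + 1) (2 * (l + 1) + 1 + 1) (by omega))) hpos
    have hB := add_pos (sub_pos.2 (hlt 2 (2 * (2 * (l + 1) + 1)) (by omega)))
      (mul_pos (sub_pos.2 (hlt (2 * (l + 1) + 1 + 1) (2 * (2 * (l + 1) + 1)) (by omega))) hpos)
    have hcast : ∀ c : ℕ, (c : ℚ) = (q : ℚ) ^ 2 - 1 → c = q ^ 2 - 1 := by
      intro c hc
      rw [← Nat.cast_inj (R := ℚ), hc, Nat.cast_sub (Nat.one_le_pow _ _ (by omega))]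
      push_cast
      ring
    have hm : ∀ (w : ℕ) (A : ℚ), Polynomial.monomial w A = A • Polynomial.monomial w 1 := by
      intro w A
      rw [Polynomial.smul_monomial, smul_eq_mul, mul_one]
    have hPos : quadraticChar K (-1) ^ (l + 1) = 1 →
        FourWeightCode.weightEnumerator (FourWeightCode.rowCode G) =
          Polynomial.monomial 0 (1 : ℚ)
          + Polynomial.monomial (q ^ (4 * l + 5)) ((q : ℚ) ^ 2 - 1)
          + Polynomial.monomial
              (q ^ (4 * l + 5) - q ^ (4 * l + 3) - q ^ (3 * l + 3) + q ^ (3 * l + 2))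
              ((q : ℚ) ^ (2 * (l + 1) + 1 + 2) - (q : ℚ) ^ (2 * (l + 1) + 1))
          + Polynomial.monomial
              (q ^ (4 * l + 5) - q ^ (4 * l + 3))
              ((q : ℚ) ^ (2 * (2 * (l + 1) + 1)) - (q : ℚ) ^ 2
                + ((q : ℚ) ^ (2 * (2 * (l + 1) + 1)) - (q : ℚ) ^ (2 * (l + 1) + 1 + 1))
                  * ((q : ℚ) ^ 2 - 1))
          + Polynomial.monomial
              (q ^ (4 * l + 5) - q ^ (4 * l + 3) + q ^ (3 * l + 2))
              (((q : ℚ) ^ (2 * (l + 1) + 1 + 1) - (q : ℚ) ^ (2 * (l + 1) + 1)) * ((q : ℚ) ^ 2 - 1)) := by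
      intro hχ
      rw [FourWeightCode.sum_sumSqCount_even_of_pos hchar hq3 hK hχ
        (fun w => Polynomial.monomial w (1 : ℚ))] at hw
      rw [hw, hm _ ((q : ℚ) ^ 2 - 1), hm _ (_ ^ (2 * (l + 1) + 1 + 2) - _),
        hm _ (_ + _ * ((q : ℚ) ^ 2 - 1)), hm _ ((_ - _) * ((q : ℚ) ^ 2 - 1))]
      module
    have hNeg : quadraticChar K (-1) ^ (l + 1) = -1 →
        FourWeightCode.weightEnumerator (FourWeightCode.rowCode G) =
          Polynomial.monomial 0 (1 : ℚ)
          + Polynomial.monomial (q ^ (4 * l + 5)) ((q : ℚ) ^ 2 - 1)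
          + Polynomial.monomial
              (q ^ (4 * l + 5) - q ^ (4 * l + 3) - q ^ (3 * l + 2))
              (((q : ℚ) ^ (2 * (l + 1) + 1 + 1) - (q : ℚ) ^ (2 * (l + 1) + 1)) * ((q : ℚ) ^ 2 - 1))
          + Polynomial.monomial
              (q ^ (4 * l + 5) - q ^ (4 * l + 3))
              ((q : ℚ) ^ (2 * (2 * (l + 1) + 1)) - (q : ℚ) ^ 2
                + ((q : ℚ) ^ (2 * (2 * (l + 1) + 1)) - (q : ℚ) ^ (2 * (l + 1) + 1 + 1))
                  * ((q : ℚ) ^ 2 - 1))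
          + Polynomial.monomial
              (q ^ (4 * l + 5) - q ^ (4 * l + 3) + q ^ (3 * l + 3) - q ^ (3 * l + 2))
              ((q : ℚ) ^ (2 * (l + 1) + 1 + 2) - (q : ℚ) ^ (2 * (l + 1) + 1)) := by
      intro hχ
      rw [FourWeightCode.sum_sumSqCount_even_of_neg hchar hq3 hK hχ
        (fun w => Polynomial.monomial w (1 : ℚ))] at hw
      rw [hw, hm _ ((q : ℚ) ^ 2 - 1), hm _ (_ ^ (2 * (l + 1) + 1 + 2) - _),
        hm _ (_ + _ * ((q : ℚ) ^ 2 - 1)), hm _ ((_ - _) * ((q : ℚ) ^ 2 - 1))]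
      module
    -- Here `r = 2 * (l + 1) + 1`, so `l + 1` is even exactly when `r % 4 = 1`.
    have hχ1 : Even (l + 1) ∨ q % 4 = 1 → quadraticChar K (-1) ^ (l + 1) = 1 := by
      intro h
      rw [← hK] at h
      exact FourWeightCode.quadraticChar_neg_one_pow_eq_one hchar h
    have hχ2 : Odd (l + 1) → q % 4 = 3 → quadraticChar K (-1) ^ (l + 1) = -1 := by
      intro h h'
      rw [← hK] at h'
      rw [quadraticChar_neg_one hchar, ZMod.χ₄_nat_three_mod_four h', h.neg_one_pow]
    refine ⟨hn, hrank, hproj, fun h => hPos (hχ1 ?_), fun h => hNeg (hχ2 ?_ h.2), fun h => ?_,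
      fun _ => ?_⟩
    · rcases h with h | h
      · exact Or.inl (Nat.even_iff.2 (by omega))
      · exact Or.inr h.2
    · exact Nat.odd_iff.2 (by omega)
    · exact absurd h (Nat.not_even_iff_odd.2 (odd_two_mul_add_one _))
    · have hq4 : q % 4 = 1 ∨ q % 4 = 3 := by
        have := Nat.odd_iff.1 hqo
        omega
      by_cases h : Even (l + 1) ∨ q % 4 = 1
      · obtain ⟨hc, hw4⟩ := FourWeightCode.four_weights_of_weightEnumerator (hPos (hχ1 h))
          hA₀ hA.ne' hB.ne' hC.ne' (by omega) (by omega) (by omega) (by omega)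
        exact ⟨hcast _ hc, hw4⟩
      · rw [not_or, Nat.not_even_iff_odd] at h
        obtain ⟨hc, hw4⟩ := FourWeightCode.four_weights_of_weightEnumerator
          (hNeg (hχ2 h.1 (hq4.resolve_left h.2)))
          hA₀ hC.ne' hB.ne' hA.ne' (by omega) (by omega) (by omega) (by omega)
        exact ⟨hcast _ hc, hw4⟩
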